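/- Let $\mathcal H$ be the twisted Heisenberg--Virasoro algebra, the complex Lie algebra with basis $L(n),I(n)$ $(n\in\mathbb Z)$, $C_L,C_{LI},C_I$, where $C_L,C_{LI},C_I$ are central and $$[L(n),L(m)]=(n-m)L(n+m)+\delta_{n,-m}\tfrac{n^3-n}{12}C_L,\quad [L(n),I(m)]=-mI(n+m)-\delta_{n,-m}(n^2+n)C_{LI},\quad [I(n),I(m)]=n\delta_{n,-m}C_I,$$ and let $W(2,2)$ be the complex Lie algebra with basis $L(n),W(n)$ $(n\in\mathbb Z)$, $C,C_W$, where $C,C_W$ are central and $$[L(n),L(m)]=(n-m)L(n+m)+\delta_{n,-m}\tfrac{n^3-n}{12}C,\quad [L(n),W(m)]=(n-m)W(n+m)+\delta_{n,-m}\tfrac{n^3-n}{12}C_W,\quad [W(n),W(m)]=0.$$ Let $V^{\mathcal H}(c_L,0,c_{L,I},h,h_I)$ be the Verma module over $\mathcal H$ with highest weight vector $v_{h,h_I}$, on which $L(0),I(0),C_L,C_I,C_{LI}$ act by $h,h_I,c_L,0,c_{L,I}$, and let $V^{W(2,2)}(c_L,c_W,h,h_W)$ be the Verma module over $W(2,2)$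 with highest weight vector $v_{h,h_W}$, on which $L(0),W(0),C,C_W$ act by $h,h_W,c_L,c_W$. The Schur polynomials $S_r$ are defined by $\exp\bigl(\sum_{n\ge1}\frac{x_n}{n}y^n\bigr)=\sum_{r\ge0}S_r(x_1,x_2,\dots)y^r$. Let $p$ be a positive integer and let $c_L,c_W,h,h_W,c_{L,I},h_I\in\mathbb C$ with $c_{L,I}\ne0$ be such that $$\frac{h_W}{c_W}=\frac{1-p^2}{24},\qquad c_W=-24c_{L,I}^2,\qquad h_W=h_I(h_I-2c_{L,I}),\qquad \frac{h_I}{c_{L,I}}-1=p .$$ Then $V^{\mathcal H}(c_L,0,c_{L,I},h,h_I)$ is a $W(2,2)$-module on which $L(n)$ acts by $L(n)$, $C$ by $c_L$, $C_W$ by $c_W$, and $W(n)$ by the coefficient of $z^{-n-2}$ in ${:}I(z)^2{:}+2c_{L,I}\,\partial_zI(z)$, that is, by $\sum_{i\in\mathbb Z}{:}I(i)I(n-i){:}-2c_{L,I}(n+1)I(n)$; let $$\Psi: V^{W(2,2)}(c_L,c_W,h,h_W)\to V^{\mathcal H}(c_L,0,c_{L,I},h,h_I)$$ be the $W(2,2)$-homomorphism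 with $\Psi(v_{h,h_W})=v_{h,h_I}$. Then the vector $$S_p\Bigl(-\frac{I(-1)}{c_{L,I}},-\frac{I(-2)}{c_{L,I}},\dots\Bigr)v_{h,h_I}$$ has exactly one preimage $u$ under $\Psi$, and $u$ is a singular vector of conformal weight $p$ in $V^{W(2,2)}(c_L,c_W,h,h_W)$: $u\neq0$, $L(n)u=W(n)u=0$ for all $n>0$, $L(0)u=(h+p)u$, and $u$ is an eigenvector of $W(0)$. -/

import Mathlib

namespace StructureConstants

variable {κ : Type*} (b : κ → κ → (κ →₀ ℂ))

/-- The bilinear bracket on the vector space with basis `κ` determined by `⁅e i, e j⁆ = b i j`. -/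
noncomputable def bracket : (κ →₀ ℂ) →ₗ[ℂ] (κ →₀ ℂ) →ₗ[ℂ] (κ →₀ ℂ) :=
  Finsupp.linearCombination ℂ fun i => Finsupp.linearCombination ℂ (b i)

@[simp] theorem bracket_single (i j : κ) :
    bracket b (Finsupp.single i 1) (Finsupp.single j 1) = b i j := by
  simp [bracket]

theorem bracket_skew (hskew : ∀ i j, b i j = -b j i) (x y : κ →₀ ℂ) :
    bracket b x y = -bracket b y x := by
  induction x using Finsupp.induction_linear with
  | zero => simp
  | add x₁ x₂ h₁ h₂ => simp only [map_add, LinearMap.add_apply, h₁, h₂, neg_add]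
  | single i r =>
    induction y using Finsupp.induction_linear with
    | zero => simp
    | add x₁ x₂ h₁ h₂ => simp only [map_add, LinearMap.add_apply, h₁, h₂, neg_add]
    | single j s =>
      rw [← Finsupp.smul_single_one i r, ← Finsupp.smul_single_one j s]
      simp only [map_smul, LinearMap.smul_apply, bracket_single, hskew i j, smul_neg]
      rw [smul_comm]

theorem bracket_self (hskew : ∀ i j, b i j = -b j i) (x : κ →₀ ℂ) : bracket b x x = 0 :=
  self_eq_neg.mp (bracket_skew b hskew x x)

theorem bracket_leibniz
    (hjac : ∀ i j k, bracket b (Finsupp.single i 1) (b j k) =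
      bracket b (b i j) (Finsupp.single k 1) + bracket b (Finsupp.single j 1) (b i k))
    (x y z : κ →₀ ℂ) :
    bracket b x (bracket b y z) = bracket b (bracket b x y) z + bracket b y (bracket b x z) := by
  induction x using Finsupp.induction_linear with
  | zero => simp
  | add x₁ x₂ h₁ h₂ => simp only [map_add, LinearMap.add_apply, h₁, h₂]; abel
  | single i r =>
    induction y using Finsupp.induction_linear with
    | zero => simp
    | add x₁ x₂ h₁ h₂ => simp only [map_add, LinearMap.add_apply, h₁, h₂]; abel
    | single j s =>
      induction z using Finsupp.induction_linear with
      | zero => simp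
      | add x₁ x₂ h₁ h₂ => simp only [map_add, h₁, h₂]; abel
      | single k t =>
        rw [← Finsupp.smul_single_one i r, ← Finsupp.smul_single_one j s,
          ← Finsupp.smul_single_one k t]
        simp only [map_smul, LinearMap.smul_apply, bracket_single]
        rw [hjac i j k]
        simp only [smul_add]
        rw [smul_comm t s, smul_comm t r, smul_comm s r]
        congr 1
        rw [smul_comm s r]

end StructureConstants

/-- Basis of the twisted Heisenberg-Virasoro algebra. -/
inductive HVirBasis : Type
  | L (n : ℤ)
  | I (n : ℤ)
  | CL
  | CLI
  | CI

/-- Basis of the Lie algebra `W(2,2)`. -/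
inductive W22Basis : Type
  | L (n : ℤ)
  | W (n : ℤ)
  | C
  | CW

open Finsupp in
/-- Brackets of basis elements of the twisted Heisenberg-Virasoro algebra. -/
noncomputable def HVirBasis.br : HVirBasis → HVirBasis → (HVirBasis →₀ ℂ)
  | .L n, .L m => single (.L (n + m)) ((n : ℂ) - m) +
      single .CL (if n = -m then ((n : ℂ) ^ 3 - n) / 12 else 0)
  | .L n, .I m => single (.I (n + m)) (-(m : ℂ)) -
      single .CLI (if n = -m then (n : ℂ) ^ 2 + n else 0)
  | .I m, .L n => -(single (.I (n + m)) (-(m : ℂ)) -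
      single .CLI (if n = -m then (n : ℂ) ^ 2 + n else 0))
  | .I n, .I m => single .CI (if n = -m then (n : ℂ) else 0)
  | _, _ => 0

open Finsupp in
/-- Brackets of basis elements of `W(2,2)`. -/
noncomputable def W22Basis.br : W22Basis → W22Basis → (W22Basis →₀ ℂ)
  | .L n, .L m => single (.L (n + m)) ((n : ℂ) - m) +
      single .C (if n = -m then ((n : ℂ) ^ 3 - n) / 12 else 0)
  | .L n, .W m => single (.W (n + m)) ((n : ℂ) - m) +
      single .CW (if n = -m then ((n : ℂ) ^ 3 - n) / 12 else 0)
  | .W m, .L n => -(single (.W (n + m)) ((n : ℂ) - m) +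
      single .CW (if n = -m then ((n : ℂ) ^ 3 - n) / 12 else 0))
  | _, _ => 0

open Finsupp in
theorem HVirBasis.br_skew (i j : HVirBasis) : i.br j = -j.br i := by
  rcases i with n | n | _ | _ | _ <;> rcases j with m | m | _ | _ | _ <;>
    simp only [HVirBasis.br, neg_zero, neg_neg]
  · rw [neg_add, ← single_neg, ← single_neg, add_comm m n, neg_sub]
    congr 2
    by_cases h : n = -m
    · subst h; simp; ring
    · rw [if_neg h, if_neg (by omega), neg_zero]
  · rw [← single_neg]
    congr 1
    by_cases h : n = -m
    · subst h; simp
    · rw [if_neg h, if_neg (by omega), neg_zero]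

open Finsupp in
theorem W22Basis.br_skew (i j : W22Basis) : i.br j = -j.br i := by
  rcases i with n | n | _ | _ <;> rcases j with m | m | _ | _ <;>
    simp only [W22Basis.br, neg_zero, neg_neg]
  rw [neg_add, ← single_neg, ← single_neg, add_comm m n, neg_sub]
  congr 2
  by_cases h : n = -m
  · subst h; simp; ring
  · rw [if_neg h, if_neg (by omega), neg_zero]

open StructureConstants Finsupp in
theorem HVirBasis.br_jacobi (i j k : HVirBasis) :
    bracket HVirBasis.br (Finsupp.single i 1) (j.br k) =
      bracket HVirBasis.br (i.br j) (Finsupp.single k 1) +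
        bracket HVirBasis.br (Finsupp.single j 1) (i.br k) := by
  rcases i with n | n | _ | _ | _ <;> rcases j with m | m | _ | _ | _ <;>
    rcases k with l | l | _ | _ | _ <;>
    simp only [HVirBasis.br, bracket, map_add, map_sub, map_neg, map_zero, LinearMap.add_apply,
      LinearMap.sub_apply, LinearMap.neg_apply, LinearMap.zero_apply, linearCombination_single,
      LinearMap.smul_apply, smul_zero, one_smul, add_zero, zero_add, sub_zero, neg_zero]
  all_goals
    try simp only [add_comm (G := ℤ), add_left_comm (G := ℤ)]
    classical
    ext q
    simp only [Finsupp.coe_add, Finsupp.coe_sub, Finsupp.coe_neg, Finsupp.coe_smul, Pi.add_apply,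
      Pi.sub_apply, Pi.neg_apply, Pi.smul_apply, smul_eq_mul, Finsupp.single_apply,
      Finsupp.coe_zero, Pi.zero_apply]
    by_cases h : n + m + l = 0
    · obtain rfl : l = -n - m := by omega
      repeat rw [if_pos (by omega : (_ : ℤ) = _)]
      split_ifs <;> push_cast <;> ring
    · repeat rw [if_neg (by omega : ¬ ((_ : ℤ) = _))]
      split_ifs <;> push_cast <;> ring

open StructureConstants Finsupp in
theorem W22Basis.br_jacobi (i j k : W22Basis) :
    bracket W22Basis.br (Finsupp.single i 1) (j.br k) =
      bracket W22Basis.br (i.br j) (Finsupp.single k 1) +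
        bracket W22Basis.br (Finsupp.single j 1) (i.br k) := by
  rcases i with n | n | _ | _ <;> rcases j with m | m | _ | _ <;>
    rcases k with l | l | _ | _ <;>
    simp only [W22Basis.br, bracket, map_add, map_sub, map_neg, map_zero, LinearMap.add_apply,
      LinearMap.sub_apply, LinearMap.neg_apply, LinearMap.zero_apply, linearCombination_single,
      LinearMap.smul_apply, smul_zero, one_smul, add_zero, zero_add, sub_zero, neg_zero]
  all_goals
    try simp only [add_comm (G := ℤ), add_left_comm (G := ℤ)]
    classical
    ext q
    simp only [Finsupp.coe_add, Finsupp.coe_sub, Finsupp.coe_neg, Finsupp.coe_smul, Pi.add_apply,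
      Pi.sub_apply, Pi.neg_apply, Pi.smul_apply, smul_eq_mul, Finsupp.single_apply,
      Finsupp.coe_zero, Pi.zero_apply]
    by_cases h : n + m + l = 0
    · obtain rfl : l = -n - m := by omega
      repeat rw [if_pos (by omega : (_ : ℤ) = _)]
      split_ifs <;> push_cast <;> ring
    · repeat rw [if_neg (by omega : ¬ ((_ : ℤ) = _))]
      split_ifs <;> push_cast <;> ring

theorem StructureConstants.linearCombination_bracket {κ : Type*} (b : κ → κ → (κ →₀ ℂ))
    {A : Type*} [Ring A] [Algebra ℂ A] (φ : κ → A)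
    (hφ : ∀ i j, Finsupp.linearCombination ℂ φ (b i j) = φ i * φ j - φ j * φ i)
    (x y : κ →₀ ℂ) :
    Finsupp.linearCombination ℂ φ (StructureConstants.bracket b x y) =
      Finsupp.linearCombination ℂ φ x * Finsupp.linearCombination ℂ φ y -
        Finsupp.linearCombination ℂ φ y * Finsupp.linearCombination ℂ φ x := by
  induction x using Finsupp.induction_linear with
  | zero => simp
  | add x₁ x₂ h₁ h₂ =>
    simp only [map_add, LinearMap.add_apply, h₁, h₂, add_mul, mul_add]; abel
  | single i r =>
    induction y using Finsupp.induction_linear with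
    | zero => simp
    | add x₁ x₂ h₁ h₂ =>
      simp only [map_add, h₁, h₂, add_mul, mul_add]; abel
    | single j s =>
      rw [← Finsupp.smul_single_one i r, ← Finsupp.smul_single_one j s]
      simp only [map_smul, LinearMap.smul_apply, StructureConstants.bracket_single, hφ,
        Finsupp.linearCombination_single, one_smul, smul_mul_assoc, mul_smul_comm, smul_sub]
      rw [smul_comm s r (φ j * φ i)]

/-- The twisted Heisenberg-Virasoro algebra: the complex vector space with basis
`L n, I n (n : ℤ), C_L, C_LI, C_I`. -/
def HVir : Type := HVirBasis →₀ ℂ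

/-- The Lie algebra `W(2,2)`: the complex vector space with basis `L n, W n (n : ℤ), C, C_W`. -/
def W22 : Type := W22Basis →₀ ℂ

namespace HVir

noncomputable instance : AddCommGroup HVir := inferInstanceAs (AddCommGroup (HVirBasis →₀ ℂ))

noncomputable instance : Module ℂ HVir := inferInstanceAs (Module ℂ (HVirBasis →₀ ℂ))

/-- The Lie bracket, determined by the brackets of the basis elements. -/
noncomputable instance : LieRing HVir where
  bracket x y := StructureConstants.bracket HVirBasis.br x y
  add_lie x y z := LinearMap.map_add₂ (StructureConstants.bracket HVirBasis.br) x y z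
  lie_add x y z := map_add (StructureConstants.bracket HVirBasis.br x) y z
  lie_self x := StructureConstants.bracket_self _ HVirBasis.br_skew x
  leibniz_lie x y z := StructureConstants.bracket_leibniz _ HVirBasis.br_jacobi x y z

noncomputable instance : LieAlgebra ℂ HVir where
  lie_smul t x y := map_smul (StructureConstants.bracket HVirBasis.br x) t y

/-- The basis element of `HVir` with index `i`. -/
noncomputable def e (i : HVirBasis) : HVir := Finsupp.single i (1 : ℂ)

theorem lie_e (i j : HVirBasis) : ⁅e i, e j⁆ = (HVirBasis.br i j : HVirBasis →₀ ℂ) :=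
  StructureConstants.bracket_single _ i j

end HVir

namespace W22

noncomputable instance : AddCommGroup W22 := inferInstanceAs (AddCommGroup (W22Basis →₀ ℂ))

noncomputable instance : Module ℂ W22 := inferInstanceAs (Module ℂ (W22Basis →₀ ℂ))

/-- The Lie bracket, determined by the brackets of the basis elements. -/
noncomputable instance : LieRing W22 where
  bracket x y := StructureConstants.bracket W22Basis.br x y
  add_lie x y z := LinearMap.map_add₂ (StructureConstants.bracket W22Basis.br) x y z
  lie_add x y z := map_add (StructureConstants.bracket W22Basis.br x) y z
  lie_self x := StructureConstants.bracket_self _ W22Basis.br_skew x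
  leibniz_lie x y z := StructureConstants.bracket_leibniz _ W22Basis.br_jacobi x y z

noncomputable instance : LieAlgebra ℂ W22 where
  lie_smul t x y := map_smul (StructureConstants.bracket W22Basis.br x) t y

/-- The basis element of `W22` with index `i`. -/
noncomputable def e (i : W22Basis) : W22 := Finsupp.single i (1 : ℂ)

end W22

section Universal

attribute [local instance 100] LieRing.ofAssociativeRing

/-- Every subalgebra of `U(g)` containing the image of `g` is everything. -/
theorem UniversalEnvelopingAlgebra.induction_of_generators {g : Type*} [LieRing g]
    [LieAlgebra ℂ g] (S : Subalgebra ℂ (UniversalEnvelopingAlgebra ℂ g))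
    (hS : ∀ x : g, UniversalEnvelopingAlgebra.ι ℂ x ∈ S)
    (u : UniversalEnvelopingAlgebra ℂ g) : u ∈ S := by
  let f : g →ₗ⁅ℂ⁆ S :=
    { toFun := fun x => ⟨UniversalEnvelopingAlgebra.ι ℂ x, hS x⟩
      map_add' := fun x y => by ext; simp
      map_smul' := fun t x => by ext; simp
      map_lie' := fun {x y} => by
        ext
        simp [LieRing.of_associative_ring_bracket] }
  have h : AlgHom.id ℂ _ = S.val.comp (UniversalEnvelopingAlgebra.lift ℂ f) := by
    ext x
    simp [f]
  have h' := congrArg (fun F => F u) h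
  simp only [AlgHom.id_apply] at h'
  change u = ((UniversalEnvelopingAlgebra.lift ℂ f) u : UniversalEnvelopingAlgebra ℂ g) at h'
  rw [h']
  exact Subtype.prop _

theorem UniversalEnvelopingAlgebra.ι_lie {g : Type*} [LieRing g] [LieAlgebra ℂ g] (x y : g) :
    UniversalEnvelopingAlgebra.ι ℂ ⁅x, y⁆ =
      UniversalEnvelopingAlgebra.ι ℂ x * UniversalEnvelopingAlgebra.ι ℂ y -
        UniversalEnvelopingAlgebra.ι ℂ y * UniversalEnvelopingAlgebra.ι ℂ x := by
  rw [LieHom.map_lie, LieRing.of_associative_ring_bracket]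

end Universal

/-- Operators `L n`, `I n` on a vector space `V` that satisfy the relations of the twisted
Heisenberg-Virasoro algebra with `C_L = cL`, `C_LI = cLI`, `C_I = 0`, and such that every vector
is annihilated by `I n` for `n` large. -/
structure IsLevelZeroRep {V : Type*} [AddCommGroup V] [Module ℂ V] (L I : ℤ → Module.End ℂ V)
    (cL cLI : ℂ) : Prop where
  LL : ∀ (n m : ℤ) (x : V), L n (L m x) = L m (L n x) + ((n : ℂ) - m) • L (n + m) x +
    (if n = -m then ((n : ℂ) ^ 3 - n) / 12 * cL else 0) • x
  LI : ∀ (n m : ℤ) (x : V), L n (I m x) = I m (L n x) + (-(m : ℂ)) • I (n + m) x -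
    (if n = -m then ((n : ℂ) ^ 2 + n) * cLI else 0) • x
  II : ∀ (n m : ℤ) (x : V), I n (I m x) = I m (I n x)
  smooth : ∀ x : V, ∃ N : ℤ, ∀ n : ℤ, N ≤ n → I n x = 0

namespace IsLevelZeroRep

variable {V : Type*} [AddCommGroup V] [Module ℂ V] {L I : ℤ → Module.End ℂ V} {cL cLI : ℂ}

/-- The value at `x` of the normally ordered product `:I(i) I(j):`, in which the mode with the
negative index is written on the left. -/
def normalOrdered (I : ℤ → Module.End ℂ V) (i j : ℤ) (x : V) : V :=
  if i < 0 then I i (I j x) else I j (I i x)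

theorem normalOrdered_eq (H : IsLevelZeroRep L I cL cLI) (i j : ℤ) (x : V) :
    normalOrdered I i j x = I i (I j x) := by
  unfold normalOrdered
  split_ifs
  · rfl
  · exact H.II _ _ _

theorem finite_quad (H : IsLevelZeroRep L I cL cLI) (n : ℤ) (x : V) :
    (Function.support fun i : ℤ => I i (I (n - i) x)).Finite := by
  obtain ⟨N, hN⟩ := H.smooth x
  refine (Set.finite_Ioo (n - N) N).subset fun i hi => ?_
  rw [Function.mem_support] at hi
  constructor
  · by_contra hlt
    exact hi (by rw [hN (n - i) (by omega), map_zero])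
  · by_contra hlt
    exact hi (by rw [H.II, hN i (by omega), map_zero])

theorem finite_normalOrdered (H : IsLevelZeroRep L I cL cLI) (n : ℤ) (x : V) :
    (Function.support fun i : ℤ => normalOrdered I i (n - i) x).Finite := by
  simpa only [H.normalOrdered_eq] using H.finite_quad n x

/-- The mode `W n` of the field `W(z) = :I(z)²: + 2 cLI ∂I(z) = ∑ W n z^(-n-2)`, which is the
field of the vector `(I(-1)² + 2 cLI I(-2)) 𝟏`. -/
noncomputable def wMode (H : IsLevelZeroRep L I cL cLI) (n : ℤ) : Module.End ℂ V where
  toFun x := (∑ᶠ i : ℤ, normalOrdered I i (n - i) x) - (2 * cLI * (n + 1)) • I n x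
  map_add' x y := by
    have h : ∀ i : ℤ, normalOrdered I i (n - i) (x + y) =
        normalOrdered I i (n - i) x + normalOrdered I i (n - i) y := fun i => by
      simp only [H.normalOrdered_eq, map_add]
    simp only [h]
    rw [finsum_add_distrib (H.finite_normalOrdered n x) (H.finite_normalOrdered n y), map_add,
      smul_add]
    abel
  map_smul' t x := by
    have h : ∀ i : ℤ, normalOrdered I i (n - i) (t • x) = t • normalOrdered I i (n - i) x :=
      fun i => by simp only [H.normalOrdered_eq, map_smul]
    simp only [h, RingHom.id_apply]
    rw [← smul_finsum, map_smul, smul_sub, smul_comm t]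

theorem wMode_apply (H : IsLevelZeroRep L I cL cLI) (n : ℤ) (x : V) :
    H.wMode n x = (∑ᶠ i : ℤ, I i (I (n - i) x)) - (2 * cLI * (n + 1)) • I n x := by
  change (∑ᶠ i : ℤ, normalOrdered I i (n - i) x) - (2 * cLI * (n + 1)) • I n x = _
  simp only [H.normalOrdered_eq]

theorem map_finsum' (f : Module.End ℂ V) {g : ℤ → V} (hg : (Function.support g).Finite) :
    f (∑ᶠ i, g i) = ∑ᶠ i, f (g i) :=
  f.toAddMonoidHom.map_finsum hg

theorem I_wMode (H : IsLevelZeroRep L I cL cLI) (k n : ℤ) (x : V) :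
    I k (H.wMode n x) = H.wMode n (I k x) := by
  rw [wMode_apply, wMode_apply, map_sub, map_finsum' _ (H.finite_quad n x), map_smul, H.II k n]
  congr 1
  refine finsum_congr fun i => ?_
  rw [H.II k i, H.II k (n - i)]

theorem wMode_wMode (H : IsLevelZeroRep L I cL cLI) (m n : ℤ) (x : V) :
    H.wMode m (H.wMode n x) = H.wMode n (H.wMode m x) := by
  rw [wMode_apply H m (H.wMode n x), wMode_apply H m x, map_sub,
    map_finsum' _ (H.finite_quad m x), map_smul]
  simp only [H.I_wMode]

theorem L_wMode (H : IsLevelZeroRep L I cL cLI) (n m : ℤ) (x : V) :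
    L n (H.wMode m x) = H.wMode m (L n x) + ((n : ℂ) - m) • H.wMode (n + m) x +
      (if n = -m then ((n : ℂ) ^ 3 - n) / 12 * (-24 * cLI ^ 2) else 0) • x := by
  have hpt : ∀ i : ℤ, L n (I i (I (m - i) x)) = I i (I (m - i) (L n x)) +
      ((-((m : ℂ) - i)) • I i (I (n + m - i) x) +
      ((-(i : ℂ)) • I (n + i) (I (m - i) x) +
      ((if i = n + m then -(((n : ℂ) ^ 2 + n) * cLI) • I (n + m) x else 0) +
      (if i = -n then -(((n : ℂ) ^ 2 + n) * cLI) • I (n + m) x else 0)))) := by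
    intro i
    rw [H.LI n i, H.LI n (m - i)]
    have h1 : n = -(m - i) ↔ i = n + m := by omega
    have h2 : n = -i ↔ i = -n := by omega
    simp only [h1, h2, map_add, map_sub, map_smul]
    have h3 : n + (m - i) = n + m - i := by ring
    rw [h3]
    have h4 : (if i = n + m then (n ^ 2 + n) * cLI else 0) • I i x =
        -(if i = n + m then -(((n : ℂ) ^ 2 + n) * cLI) • I (n + m) x else 0) := by
      split_ifs with h
      · rw [h, neg_smul, neg_neg]
      · simp
    have h5 : (if i = -n then (n ^ 2 + n) * cLI else 0) • I (m - i) x =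
        -(if i = -n then -(((n : ℂ) ^ 2 + n) * cLI) • I (n + m) x else 0) := by
      split_ifs with h
      · rw [h, neg_smul, neg_neg, sub_neg_eq_add, add_comm m n]
      · simp
    rw [h4, h5]
    push_cast
    abel
  have hshift : (fun i : ℤ => (-(i : ℂ)) • I (n + i) (I (m - i) x)) =
      (fun i : ℤ => ((n : ℂ) - i) • I i (I (n + m - i) x)) ∘ (Equiv.addLeft n) := by
    funext i
    simp only [Function.comp_apply, Equiv.coe_addLeft]
    congr 2
    · push_cast; ring
    · congr 2; ring
  have fadd : ∀ {f g : ℤ → V}, (Function.support f).Finite → (Function.support g).Finite →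
      (Function.support fun i => f i + g i).Finite := fun hf hg =>
    (hf.union hg).subset (Function.support_add _ _)
  have f1 := H.finite_quad m (L n x)
  have f2 : (Function.support fun i : ℤ =>
      (-((m : ℂ) - i)) • I i (I (n + m - i) x)).Finite :=
    (H.finite_quad (n + m) x).subset fun i hi h0 => hi (by simp only [h0, smul_zero])
  have f3' : (Function.support fun i : ℤ =>
      ((n : ℂ) - i) • I i (I (n + m - i) x)).Finite :=
    (H.finite_quad (n + m) x).subset fun i hi h0 => hi (by simp only [h0, smul_zero])
  have f3 : (Function.support fun i : ℤ =>
      (-(i : ℂ)) • I (n + i) (I (m - i) x)).Finite := by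
    rw [hshift, Function.support_comp_eq_preimage]
    exact f3'.preimage (Equiv.injective _).injOn
  have f45 : ∀ (a : ℤ) (y : V), (Function.support fun i : ℤ => if i = a then y else 0).Finite :=
    fun a y => (Set.finite_singleton a).subset fun i hi => by
      by_contra h
      exact hi (if_neg h)
  have s45 : ∀ (a : ℤ) (y : V), (∑ᶠ i : ℤ, if i = a then y else 0) = y := fun a y => by
    rw [finsum_eq_single _ a fun i hi => if_neg hi, if_pos rfl]
  have s23 : (∑ᶠ i : ℤ, (-((m : ℂ) - i)) • I i (I (n + m - i) x)) +
      (∑ᶠ i : ℤ, (-(i : ℂ)) • I (n + i) (I (m - i) x)) =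
      ((n : ℂ) - m) • ∑ᶠ i : ℤ, I i (I (n + m - i) x) := by
    have s3 : (∑ᶠ i : ℤ, (-(i : ℂ)) • I (n + i) (I (m - i) x)) =
        ∑ᶠ i : ℤ, ((n : ℂ) - i) • I i (I (n + m - i) x) := by
      rw [hshift]
      exact finsum_comp_equiv (Equiv.addLeft n)
        (f := fun i : ℤ => ((n : ℂ) - i) • I i (I (n + m - i) x))
    rw [s3, ← finsum_add_distrib f2 f3', smul_finsum]
    refine finsum_congr fun i => ?_
    rw [← add_smul]
    congr 1
    ring
  rw [wMode_apply, wMode_apply, wMode_apply, map_sub, map_finsum' _ (H.finite_quad m x),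
    finsum_congr hpt,
    finsum_add_distrib f1 (fadd f2 (fadd f3 (fadd (f45 _ _) (f45 _ _)))),
    finsum_add_distrib f2 (fadd f3 (fadd (f45 _ _) (f45 _ _))),
    finsum_add_distrib f3 (fadd (f45 _ _) (f45 _ _)),
    finsum_add_distrib (f45 _ _) (f45 _ _), s45, s45, ← add_assoc (∑ᶠ i : ℤ, _ • _), s23,
    map_smul, H.LI n m]
  push_cast
  split_ifs with h
  · have h' : (n : ℂ) = -m := by rw [h]; push_cast; ring
    rw [h']
    module
  · module

/-- The action of the basis elements of `W(2,2)` by the operators `L n`, `W n` and by the scalars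
`C = cL`, `C_W = -24 cLI²`. -/
noncomputable def w22Basis (H : IsLevelZeroRep L I cL cLI) : W22Basis → Module.End ℂ V
  | .L n => L n
  | .W n => H.wMode n
  | .C => cL • 1
  | .CW => (-24 * cLI ^ 2) • 1

theorem w22Basis_br (H : IsLevelZeroRep L I cL cLI) (i j : W22Basis) :
    Finsupp.linearCombination ℂ H.w22Basis (W22Basis.br i j) =
      H.w22Basis i * H.w22Basis j - H.w22Basis j * H.w22Basis i := by
  have hLL (n m : ℤ) := H.LL n m
  have hLW (n m : ℤ) := H.L_wMode n m
  have hWW (n m : ℤ) := H.wMode_wMode n m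
  rcases i with n | n | _ | _ <;> rcases j with m | m | _ | _ <;>
    ext x <;>
    simp only [W22Basis.br, w22Basis, map_add, map_neg, map_zero,
      Finsupp.linearCombination_single, LinearMap.add_apply, LinearMap.sub_apply,
      LinearMap.neg_apply, LinearMap.smul_apply, LinearMap.zero_apply, Module.End.mul_apply,
      Module.End.one_apply, map_smul, sub_self]
  · rw [hLL n m x, ← ite_zero_mul]
    module
  · rw [hLW n m x, ← ite_zero_mul]
    module
  · rw [hLW m n x, ← ite_zero_mul]
    module
  · rw [hWW n m x, sub_self]
  · rw [smul_comm, sub_self]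
  · rw [smul_comm, sub_self]

section Lift

attribute [local instance 100] LieRing.ofAssociativeRing

/-- The representation of `W(2,2)` on `V` by the operators `L n`, `W n`. -/
noncomputable def w22Rep (H : IsLevelZeroRep L I cL cLI) : W22 →ₗ⁅ℂ⁆ Module.End ℂ V where
  toFun x := Finsupp.linearCombination ℂ H.w22Basis x
  map_add' x y := map_add (Finsupp.linearCombination ℂ H.w22Basis) x y
  map_smul' t x := map_smul (Finsupp.linearCombination ℂ H.w22Basis) t x
  map_lie' {x y} :=
    StructureConstants.linearCombination_bracket W22Basis.br H.w22Basis H.w22Basis_br x y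

/-- The resulting action of `U(W(2,2))` on `V`. -/
noncomputable def w22Action (H : IsLevelZeroRep L I cL cLI) :
    UniversalEnvelopingAlgebra ℂ W22 →ₐ[ℂ] Module.End ℂ V :=
  UniversalEnvelopingAlgebra.lift ℂ H.w22Rep

theorem w22Action_e (H : IsLevelZeroRep L I cL cLI) (i : W22Basis) :
    H.w22Action (UniversalEnvelopingAlgebra.ι ℂ (W22.e i)) = H.w22Basis i := by
  rw [w22Action, UniversalEnvelopingAlgebra.lift_ι_apply]
  change Finsupp.linearCombination ℂ H.w22Basis (Finsupp.single i 1) = _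
  simp

end Lift

end IsLevelZeroRep

namespace HVir

/-- The universal enveloping algebra of the twisted Heisenberg-Virasoro algebra. -/
abbrev U : Type := UniversalEnvelopingAlgebra ℂ HVir

/-- The element `L n` of the enveloping algebra. -/
noncomputable def L (n : ℤ) : U := UniversalEnvelopingAlgebra.ι ℂ (e (.L n))

/-- The element `I n` of the enveloping algebra. -/
noncomputable def I (n : ℤ) : U := UniversalEnvelopingAlgebra.ι ℂ (e (.I n))

/-- The central element `C_L`. -/
noncomputable def CL : U := UniversalEnvelopingAlgebra.ι ℂ (e .CL)

/-- The central element `C_LI`. -/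
noncomputable def CLI : U := UniversalEnvelopingAlgebra.ι ℂ (e .CLI)

/-- The central element `C_I`. -/
noncomputable def CI : U := UniversalEnvelopingAlgebra.ι ℂ (e .CI)

/-- The generators of the left ideal of `U` that defines the Verma module of highest weight
`(cL, cI, cLI, h, hI)`. -/
inductive VermaRel (cL cI cLI h hI : ℂ) : U → Prop
  | L_pos (n : ℤ) (hn : 0 < n) : VermaRel cL cI cLI h hI (L n)
  | I_pos (n : ℤ) (hn : 0 < n) : VermaRel cL cI cLI h hI (I n)
  | L_zero : VermaRel cL cI cLI h hI (L 0 - algebraMap ℂ U h)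
  | I_zero : VermaRel cL cI cLI h hI (I 0 - algebraMap ℂ U hI)
  | CL : VermaRel cL cI cLI h hI (CL - algebraMap ℂ U cL)
  | CI : VermaRel cL cI cLI h hI (CI - algebraMap ℂ U cI)
  | CLI : VermaRel cL cI cLI h hI (CLI - algebraMap ℂ U cLI)

/-- The left ideal of `U` that annihilates the highest weight vector. -/
noncomputable def vermaIdeal (cL cI cLI h hI : ℂ) : Submodule U U :=
  Submodule.span U {x | VermaRel cL cI cLI h hI x}

/-- The Verma module of highest weight `(cL, cI, cLI, h, hI)` over the twisted
Heisenberg-Virasoro algebra, a left module over `U`. -/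
abbrev Verma (cL cI cLI h hI : ℂ) : Type := U ⧸ vermaIdeal cL cI cLI h hI

/-- The highest weight vector of the Verma module. -/
noncomputable def hwv (cL cI cLI h hI : ℂ) : Verma cL cI cLI h hI := Submodule.Quotient.mk 1

variable {cL cI cLI h hI : ℂ}

theorem smul_hwv (u : U) :
    u • hwv cL cI cLI h hI = Submodule.Quotient.mk u := by
  rw [hwv, ← Submodule.Quotient.mk_smul, smul_eq_mul, mul_one]

theorem smul_hwv_eq_zero {u : U} (hu : VermaRel cL cI cLI h hI u) :
    u • hwv cL cI cLI h hI = 0 := by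
  rw [smul_hwv]
  exact (Submodule.Quotient.mk_eq_zero _).2 (Submodule.subset_span hu)

theorem smul_hwv_eq_smul {u : U} {a : ℂ} (hu : VermaRel cL cI cLI h hI (u - algebraMap ℂ U a)) :
    u • hwv cL cI cLI h hI = a • hwv cL cI cLI h hI := by
  have := smul_hwv_eq_zero hu
  rwa [sub_smul, sub_eq_zero, algebraMap_smul] at this

/-- Induction on the vectors of a Verma module. -/
theorem verma_induction {P : Verma cL cI cLI h hI → Prop} (hv : P (hwv cL cI cLI h hI))
    (hadd : ∀ x y, P x → P y → P (x + y)) (hsmul : ∀ (t : ℂ) x, P x → P (t • x))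
    (hg : ∀ (i : HVirBasis) x, P x → P (UniversalEnvelopingAlgebra.ι ℂ (e i) • x))
    (x : Verma cL cI cLI h hI) : P x := by
  have h0 : P 0 := by simpa using hsmul 0 _ hv
  let S : Subalgebra ℂ U :=
    { carrier := {u | ∀ x, P x → P (u • x)}
      mul_mem' := fun {a b} ha hb x hx => by
        rw [mul_smul]; exact ha _ (hb _ hx)
      add_mem' := fun {a b} ha hb x hx => by
        rw [add_smul]; exact hadd _ _ (ha _ hx) (hb _ hx)
      algebraMap_mem' := fun t x hx => by
        rw [algebraMap_smul]; exact hsmul t _ hx }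
  have hS : ∀ y : HVir, UniversalEnvelopingAlgebra.ι ℂ y ∈ S := by
    intro y
    induction y using Finsupp.induction_linear with
    | zero =>
      have : UniversalEnvelopingAlgebra.ι ℂ (0 : HVir) ∈ S := by
        rw [map_zero]; exact S.zero_mem
      exact this
    | add y z hy hz =>
      have : UniversalEnvelopingAlgebra.ι ℂ ((id y : HVir) + (id z : HVir)) ∈ S := by
        rw [map_add]; exact S.add_mem hy hz
      exact this
    | single i t =>
      have h1 : (Finsupp.single i t : HVirBasis →₀ ℂ) = (t • e i : HVir) :=
        (Finsupp.smul_single_one i t).symm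
      have : UniversalEnvelopingAlgebra.ι ℂ (t • e i) ∈ S := by
        rw [map_smul]; exact S.smul_mem (fun x hx => hg i x hx) t
      rw [h1]
      exact this
  induction x using Submodule.Quotient.induction_on with
  | H u =>
    rw [← smul_hwv]
    exact UniversalEnvelopingAlgebra.induction_of_generators S hS u _ hv

theorem ι_smul_ι_smul (i j : HVirBasis) (x : Verma cL cI cLI h hI) :
    UniversalEnvelopingAlgebra.ι ℂ (e i) • UniversalEnvelopingAlgebra.ι ℂ (e j) • x =
      UniversalEnvelopingAlgebra.ι ℂ (e j) • UniversalEnvelopingAlgebra.ι ℂ (e i) • x +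
        UniversalEnvelopingAlgebra.ι ℂ (⁅e i, e j⁆ : HVir) • x := by
  rw [UniversalEnvelopingAlgebra.ι_lie, sub_smul, mul_smul, mul_smul]
  abel

theorem ι_central_smul (c : HVirBasis) (hc : ∀ i, ⁅e c, e i⁆ = (0 : HVir)) (a : ℂ)
    (ha : VermaRel cL cI cLI h hI (UniversalEnvelopingAlgebra.ι ℂ (e c) - algebraMap ℂ U a))
    (x : Verma cL cI cLI h hI) : UniversalEnvelopingAlgebra.ι ℂ (e c) • x = a • x := by
  induction x using verma_induction with
  | hv => exact smul_hwv_eq_smul ha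
  | hadd x y hx hy => rw [smul_add, smul_add, hx, hy]
  | hsmul t x hx => rw [smul_comm, hx, smul_comm]
  | hg i x hx => rw [ι_smul_ι_smul, hx, hc, map_zero, zero_smul, add_zero, smul_comm]

theorem CL_smul (x : Verma cL cI cLI h hI) : CL • x = cL • x :=
  ι_central_smul .CL (fun i => by rw [lie_e]; cases i <;> rfl) cL .CL x

theorem CLI_smul (x : Verma cL cI cLI h hI) : CLI • x = cLI • x :=
  ι_central_smul .CLI (fun i => by rw [lie_e]; cases i <;> rfl) cLI .CLI x

theorem CI_smul (x : Verma cL cI cLI h hI) : CI • x = cI • x :=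
  ι_central_smul .CI (fun i => by rw [lie_e]; cases i <;> rfl) cI .CI x

theorem single_eq (i : HVirBasis) (t : ℂ) :
    (Finsupp.single i t : HVirBasis →₀ ℂ) = (t • e i : HVir) :=
  (Finsupp.smul_single_one i t).symm

theorem lie_LL (n m : ℤ) : ⁅e (.L n), e (.L m)⁆ = ((n : ℂ) - m) • e (.L (n + m)) +
    (if n = -m then ((n : ℂ) ^ 3 - n) / 12 else 0) • e .CL := by
  rw [lie_e]
  simp only [HVirBasis.br, single_eq]
  rfl

theorem lie_LI (n m : ℤ) : ⁅e (.L n), e (.I m)⁆ = (-(m : ℂ)) • e (.I (n + m)) -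
    (if n = -m then (n : ℂ) ^ 2 + n else 0) • e .CLI := by
  rw [lie_e]
  simp only [HVirBasis.br, single_eq]
  rfl

theorem lie_II (n m : ℤ) : ⁅e (.I n), e (.I m)⁆ = (if n = -m then (n : ℂ) else 0) • e .CI := by
  rw [lie_e]
  simp only [HVirBasis.br, single_eq]

theorem L_smul_L_smul (n m : ℤ) (x : Verma cL cI cLI h hI) : L n • L m • x =
    L m • L n • x + ((n : ℂ) - m) • L (n + m) • x +
      (if n = -m then ((n : ℂ) ^ 3 - n) / 12 * cL else 0) • x := by
  have := ι_smul_ι_smul (.L n) (.L m) x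
  rw [lie_LL, map_add, map_smul, map_smul, add_smul, smul_assoc, smul_assoc] at this
  refine this.trans ?_
  change _ + (_ + _ • CL • x) = _
  rw [CL_smul, smul_smul (if n = -m then _ else _) cL x, ite_zero_mul, ← add_assoc]
  rfl

theorem L_smul_I_smul (n m : ℤ) (x : Verma cL cI cLI h hI) : L n • I m • x =
    I m • L n • x + (-(m : ℂ)) • I (n + m) • x -
      (if n = -m then ((n : ℂ) ^ 2 + n) * cLI else 0) • x := by
  have := ι_smul_ι_smul (.L n) (.I m) x
  rw [lie_LI, map_sub, map_smul, map_smul, sub_smul, smul_assoc, smul_assoc] at this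
  refine this.trans ?_
  change _ + (_ - _ • CLI • x) = _
  rw [CLI_smul, smul_smul (if n = -m then _ else _) cLI x, ite_zero_mul, ← add_sub_assoc]
  rfl

theorem I_smul_I_smul (n m : ℤ) (x : Verma cL 0 cLI h hI) : I n • I m • x = I m • I n • x := by
  have := ι_smul_ι_smul (.I n) (.I m) x
  rw [lie_II, map_smul, smul_assoc] at this
  refine this.trans ?_
  change _ + _ • CI • x = _
  rw [CI_smul, zero_smul, smul_zero, add_zero]
  rfl

/-- The operator `L n` on the Verma module. -/
noncomputable def opL (cL cI cLI h hI : ℂ) (n : ℤ) : Module.End ℂ (Verma cL cI cLI h hI) :=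
  Algebra.lsmul ℂ ℂ _ (L n)

/-- The operator `I n` on the Verma module. -/
noncomputable def opI (cL cI cLI h hI : ℂ) (n : ℤ) : Module.End ℂ (Verma cL cI cLI h hI) :=
  Algebra.lsmul ℂ ℂ _ (I n)

theorem I_smooth (x : Verma cL 0 cLI h hI) : ∃ N : ℤ, ∀ n : ℤ, N ≤ n → I n • x = 0 := by
  induction x using verma_induction with
  | hv => exact ⟨1, fun n hn => smul_hwv_eq_zero (.I_pos n (by omega))⟩
  | hadd x y hx hy =>
    obtain ⟨N, hN⟩ := hx
    obtain ⟨M, hM⟩ := hy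
    refine ⟨max N M, fun n hn => ?_⟩
    rw [smul_add, hN n (le_trans (le_max_left _ _) hn), hM n (le_trans (le_max_right _ _) hn),
      add_zero]
  | hsmul t x hx =>
    obtain ⟨N, hN⟩ := hx
    exact ⟨N, fun n hn => by rw [smul_comm, hN n hn, smul_zero]⟩
  | hg i x hx =>
    obtain ⟨N, hN⟩ := hx
    rcases i with m | m | _ | _ | _
    · refine ⟨max N (max (N - m) (1 - m)), fun n hn => ?_⟩
      have h1 : N ≤ n := le_trans (le_max_left _ _) hn
      have h2 : N - m ≤ n := le_trans (le_max_left _ _) (le_trans (le_max_right _ _) hn)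
      have h3 : 1 - m ≤ n := le_trans (le_max_right _ _) (le_trans (le_max_right _ _) hn)
      have := L_smul_I_smul m n x
      rw [hN n h1, hN (m + n) (by omega), if_neg (by omega), smul_zero, smul_zero, zero_smul,
        add_zero, sub_zero] at this
      exact this.symm
    · refine ⟨N, fun n hn => ?_⟩
      change I n • I m • x = 0
      rw [I_smul_I_smul, hN n hn, smul_zero]
    · refine ⟨N, fun n hn => ?_⟩
      change I n • CL • x = 0
      rw [CL_smul, smul_comm, hN n hn, smul_zero]
    · refine ⟨N, fun n hn => ?_⟩
      change I n • CLI • x = 0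
      rw [CLI_smul, smul_comm, hN n hn, smul_zero]
    · refine ⟨N, fun n hn => ?_⟩
      change I n • CI • x = 0
      rw [CI_smul, smul_comm, hN n hn, smul_zero]

theorem isLevelZeroRep (cL cLI h hI : ℂ) :
    IsLevelZeroRep (opL cL 0 cLI h hI) (opI cL 0 cLI h hI) cL cLI where
  LL n m x := L_smul_L_smul n m x
  LI n m x := L_smul_I_smul n m x
  II n m x := I_smul_I_smul n m x
  smooth x := I_smooth x

/-- The operator `W n` on the level zero Verma module of the twisted Heisenberg-Virasoro
algebra. -/
noncomputable def opW (cL cLI h hI : ℂ) (n : ℤ) : Module.End ℂ (Verma cL 0 cLI h hI) :=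
  (isLevelZeroRep cL cLI h hI).wMode n

theorem opW_hwv_pos (n : ℤ) (hn : 0 < n) : opW cL cLI h hI n (hwv cL 0 cLI h hI) = 0 := by
  have hI' : ∀ k : ℤ, 0 < k → opI cL 0 cLI h hI k (hwv cL 0 cLI h hI) = 0 := fun k hk =>
    smul_hwv_eq_zero (.I_pos k hk)
  rw [opW, IsLevelZeroRep.wMode_apply, hI' n hn, smul_zero, sub_zero,
    finsum_eq_zero_of_forall_eq_zero]
  intro i
  by_cases hi : 0 < i
  · rw [(isLevelZeroRep cL cLI h hI).II, hI' i hi, map_zero]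
  · rw [hI' (n - i) (by omega), map_zero]

theorem opW_hwv_zero : opW cL cLI h hI 0 (hwv cL 0 cLI h hI) =
    (hI * (hI - 2 * cLI)) • hwv cL 0 cLI h hI := by
  have hI' : ∀ k : ℤ, 0 < k → opI cL 0 cLI h hI k (hwv cL 0 cLI h hI) = 0 := fun k hk =>
    smul_hwv_eq_zero (.I_pos k hk)
  have hI0 : opI cL 0 cLI h hI 0 (hwv cL 0 cLI h hI) = hI • hwv cL 0 cLI h hI :=
    smul_hwv_eq_smul .I_zero
  rw [opW, IsLevelZeroRep.wMode_apply, finsum_eq_single _ 0, sub_zero, hI0, map_smul, hI0]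
  · simp only [Int.cast_zero]
    module
  · intro i hi
    rcases lt_or_gt_of_ne hi with h0 | h0
    · rw [hI' (0 - i) (by omega), map_zero]
    · rw [(isLevelZeroRep cL cLI h hI).II, hI' i h0, map_zero]

end HVir

namespace W22

/-- The universal enveloping algebra of `W(2,2)`. -/
abbrev U : Type := UniversalEnvelopingAlgebra ℂ W22

/-- The element `L n` of the enveloping algebra. -/
noncomputable def L (n : ℤ) : U := UniversalEnvelopingAlgebra.ι ℂ (e (.L n))

/-- The element `W n` of the enveloping algebra. -/
noncomputable def W (n : ℤ) : U := UniversalEnvelopingAlgebra.ι ℂ (e (.W n))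

/-- The central element `C`. -/
noncomputable def C : U := UniversalEnvelopingAlgebra.ι ℂ (e .C)

/-- The central element `C_W`. -/
noncomputable def CW : U := UniversalEnvelopingAlgebra.ι ℂ (e .CW)

/-- The generators of the left ideal of `U` that defines the Verma module of central charge
`(cL, cW)` and highest weight `(h, hW)`. -/
inductive VermaRel (cL cW h hW : ℂ) : U → Prop
  | L_pos (n : ℤ) (hn : 0 < n) : VermaRel cL cW h hW (L n)
  | W_pos (n : ℤ) (hn : 0 < n) : VermaRel cL cW h hW (W n)
  | L_zero : VermaRel cL cW h hW (L 0 - algebraMap ℂ U h)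
  | W_zero : VermaRel cL cW h hW (W 0 - algebraMap ℂ U hW)
  | C : VermaRel cL cW h hW (C - algebraMap ℂ U cL)
  | CW : VermaRel cL cW h hW (CW - algebraMap ℂ U cW)

/-- The left ideal of `U` that annihilates the highest weight vector. -/
noncomputable def vermaIdeal (cL cW h hW : ℂ) : Submodule U U :=
  Submodule.span U {x | VermaRel cL cW h hW x}

/-- The Verma module of central charge `(cL, cW)` and highest weight `(h, hW)` over `W(2,2)`,
a left module over `U`. -/
abbrev Verma (cL cW h hW : ℂ) : Type := U ⧸ vermaIdeal cL cW h hW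

/-- The highest weight vector of the Verma module. -/
noncomputable def hwv (cL cW h hW : ℂ) : Verma cL cW h hW := Submodule.Quotient.mk 1

/-- `u` is a singular vector of conformal weight `p`: a nonzero vector that is annihilated by
all `L n`, `W n` with `n > 0` and is an eigenvector of `L 0`, with eigenvalue `h + p`, and
of `W 0`. -/
structure IsSingularVector {cL cW h hW : ℂ} (u : Verma cL cW h hW) (p : ℕ) : Prop where
  ne_zero : u ≠ 0
  L_pos : ∀ n : ℤ, 0 < n → L n • u = 0
  W_pos : ∀ n : ℤ, 0 < n → W n • u = 0
  L_zero : L 0 • u = (h + p) • u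
  W_zero : ∃ a : ℂ, W 0 • u = a • u

end W22

section Psi

variable {cL cW cLI h hW hI : ℂ}

/-- The action of `U(W(2,2))` on the level zero Verma module of the twisted Heisenberg-Virasoro
algebra: `L n` acts by `L n`, `W n` by `opW n`, `C` by `cL` and `C_W` by `-24 cLI²`. -/
noncomputable def w22Action (cL cLI h hI : ℂ) :
    W22.U →ₐ[ℂ] Module.End ℂ (HVir.Verma cL 0 cLI h hI) :=
  (HVir.isLevelZeroRep cL cLI h hI).w22Action

theorem w22Action_L (n : ℤ) : w22Action cL cLI h hI (W22.L n) = HVir.opL cL 0 cLI h hI n :=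
  IsLevelZeroRep.w22Action_e _ _

theorem w22Action_W (n : ℤ) : w22Action cL cLI h hI (W22.W n) = HVir.opW cL cLI h hI n :=
  IsLevelZeroRep.w22Action_e _ _

theorem w22Action_C : w22Action cL cLI h hI W22.C = cL • 1 :=
  IsLevelZeroRep.w22Action_e _ _

theorem w22Action_CW : w22Action cL cLI h hI W22.CW = (-24 * cLI ^ 2) • 1 :=
  IsLevelZeroRep.w22Action_e _ _

/-- The map `u ↦ u v` from `U(W(2,2))` to the level zero Verma module of the twisted
Heisenberg-Virasoro algebra, where `v` is the highest weight vector. -/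
noncomputable def w22Orbit (cL cLI h hI : ℂ) : W22.U →ₗ[ℂ] HVir.Verma cL 0 cLI h hI :=
  (LinearMap.applyₗ (HVir.hwv cL 0 cLI h hI)).comp (w22Action cL cLI h hI).toLinearMap

theorem w22Orbit_apply (u : W22.U) :
    w22Orbit cL cLI h hI u = w22Action cL cLI h hI u (HVir.hwv cL 0 cLI h hI) := rfl

theorem vermaIdeal_le_ker (hcW : cW = -24 * cLI ^ 2) (hhW : hW = hI * (hI - 2 * cLI)) :
    (W22.vermaIdeal cL cW h hW).restrictScalars ℂ ≤ LinearMap.ker (w22Orbit cL cLI h hI) := by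
  intro u hu
  rw [LinearMap.mem_ker, w22Orbit_apply]
  rw [Submodule.restrictScalars_mem] at hu
  induction hu using Submodule.span_induction with
  | mem x hx =>
    cases hx with
    | L_pos n hn => rw [w22Action_L]; exact HVir.smul_hwv_eq_zero (.L_pos n hn)
    | W_pos n hn => rw [w22Action_W]; exact HVir.opW_hwv_pos n hn
    | L_zero =>
      rw [map_sub, w22Action_L, AlgHom.commutes, LinearMap.sub_apply, sub_eq_zero]
      exact HVir.smul_hwv_eq_smul .L_zero
    | W_zero =>
      rw [map_sub, w22Action_W, AlgHom.commutes, LinearMap.sub_apply, HVir.opW_hwv_zero, hhW,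
        sub_eq_zero]
      rfl
    | C =>
      rw [map_sub, w22Action_C, AlgHom.commutes, LinearMap.sub_apply, sub_eq_zero]
      rfl
    | CW =>
      rw [map_sub, w22Action_CW, AlgHom.commutes, LinearMap.sub_apply, hcW, sub_eq_zero]
      rfl
  | zero => simp
  | add x y _ _ hx hy => rw [map_add, LinearMap.add_apply, hx, hy, add_zero]
  | smul a x _ hx => rw [smul_eq_mul, map_mul, Module.End.mul_apply, hx, map_zero]

/-- The homomorphism `Ψ` of `W(2,2)`-modules from the Verma module of `W(2,2)` to the level zero
Verma module of the twisted Heisenberg-Virasoro algebra that sends the class of `u` to `u v`; in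
particular it sends the highest weight vector to the highest weight vector. -/
noncomputable def Psi (hcW : cW = -24 * cLI ^ 2) (hhW : hW = hI * (hI - 2 * cLI)) :
    W22.Verma cL cW h hW →ₗ[ℂ] HVir.Verma cL 0 cLI h hI :=
  (((W22.vermaIdeal cL cW h hW).restrictScalars ℂ).liftQ (w22Orbit cL cLI h hI)
    (vermaIdeal_le_ker hcW hhW)).comp
      (Submodule.Quotient.restrictScalarsEquiv ℂ (W22.vermaIdeal cL cW h hW)).symm.toLinearMap

theorem Psi_mk (hcW : cW = -24 * cLI ^ 2) (hhW : hW = hI * (hI - 2 * cLI)) (u : W22.U) :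
    Psi (cL := cL) (h := h) hcW hhW (Submodule.Quotient.mk u) =
      w22Action cL cLI h hI u (HVir.hwv cL 0 cLI h hI) := rfl

theorem Psi_hwv (hcW : cW = -24 * cLI ^ 2) (hhW : hW = hI * (hI - 2 * cLI)) :
    Psi hcW hhW (W22.hwv cL cW h hW) = HVir.hwv cL 0 cLI h hI := by
  rw [W22.hwv, Psi_mk, map_one, Module.End.one_apply]

theorem Psi_smul (hcW : cW = -24 * cLI ^ 2) (hhW : hW = hI * (hI - 2 * cLI)) (u : W22.U)
    (x : W22.Verma cL cW h hW) :
    Psi hcW hhW (u • x) = w22Action cL cLI h hI u (Psi hcW hhW x) := by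
  induction x using Submodule.Quotient.induction_on with
  | H y =>
    rw [← Submodule.Quotient.mk_smul, smul_eq_mul, Psi_mk, Psi_mk, map_mul, Module.End.mul_apply]

end Psi

/-- The power series `∑_{n ≥ 1} (x n / n) y ^ n` in `y`, where the variable `X n` stands for
`x n`; the variable `X 0` does not occur. -/
noncomputable def schurExponent : PowerSeries (MvPolynomial ℕ ℂ) :=
  PowerSeries.mk fun n : ℕ =>
    if n = 0 then 0 else MvPolynomial.C (1 / (n : ℂ)) * MvPolynomial.X n

theorem hasSubst_schurExponent : PowerSeries.HasSubst schurExponent :=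
  PowerSeries.HasSubst.of_constantCoeff_zero' (by
    rw [← PowerSeries.coeff_zero_eq_constantCoeff_apply, schurExponent, PowerSeries.coeff_mk,
      if_pos rfl])

/-- The Schur polynomials `S r (x 1, x 2, …)`, with generating function
`exp (∑_{n ≥ 1} (x n / n) y ^ n) = ∑_{r ≥ 0} S r (x 1, x 2, …) y ^ r`. -/
noncomputable def schurPoly (r : ℕ) : MvPolynomial ℕ ℂ :=
  PowerSeries.coeff r ((PowerSeries.exp (MvPolynomial ℕ ℂ)).subst schurExponent)

open scoped IsMulCommutative in
/-- Evaluation of polynomials at a family of pairwise commuting elements of an algebra. -/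
noncomputable def evalCommuting {A : Type*} [Ring A] [Algebra ℂ A] (a : ℕ → A)
    (ha : ∀ i j, a i * a j = a j * a i) : MvPolynomial ℕ ℂ →ₐ[ℂ] A :=
  haveI : IsMulCommutative (Algebra.adjoin ℂ (Set.range a)) :=
    Algebra.isMulCommutative_adjoin ℂ (by rintro _ ⟨i, rfl⟩ _ ⟨j, rfl⟩; exact ha i j)
  (Algebra.adjoin ℂ (Set.range a)).val.comp
    (MvPolynomial.aeval fun i => ⟨a i, Algebra.subset_adjoin ⟨i, rfl⟩⟩)

theorem evalCommuting_X {A : Type*} [Ring A] [Algebra ℂ A] (a : ℕ → A)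
    (ha : ∀ i j, a i * a j = a j * a i) (i : ℕ) :
    evalCommuting a ha (MvPolynomial.X i) = a i := by
  simp [evalCommuting]

theorem HVir.I_neg_commute (i j : ℕ) :
    I (-(i : ℤ)) * I (-(j : ℤ)) = I (-(j : ℤ)) * I (-(i : ℤ)) := by
  have h : (⁅e (.I (-(i : ℤ))), e (.I (-(j : ℤ)))⁆ : HVir) = 0 := by
    rw [lie_II]
    split_ifs with hij
    · have : i = 0 := by omega
      subst this
      simp
    · exact zero_smul _ _
  have h' := congrArg (UniversalEnvelopingAlgebra.ι ℂ) h
  rw [UniversalEnvelopingAlgebra.ι_lie, map_zero, sub_eq_zero] at h'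
  exact h'

/-- The vector `S p (-I(-1)/cLI, -I(-2)/cLI, …) v` of the Verma module of the twisted
Heisenberg-Virasoro algebra, `v` being the highest weight vector. -/
noncomputable def schurVector (cL cI cLI h hI : ℂ) (p : ℕ) : HVir.Verma cL cI cLI h hI :=
  evalCommuting (fun n : ℕ => -((1 / cLI) • HVir.I (-(n : ℤ))))
    (fun i j => by
      simp only [neg_mul_neg, smul_mul_assoc, mul_smul_comm, HVir.I_neg_commute i j])
    (schurPoly p) • HVir.hwv cL cI cLI h hI

/-!
For vectors `x` on which the modes `I n`, `n > 0`, vanish and `I 0` acts by `hI`, the vector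
`W (-m - 1) x` is `2 (hI + m cLI) I (-m - 1) x` plus a sum of terms `I (-j) I (-k) x` with
`1 ≤ j, k ≤ m`. As `hI = (p + 1) cLI`, the coefficient never vanishes, so the range of `Ψ` contains
all polynomials in the `I (-k)`, `k > 0`, applied to the highest weight vector, in particular the
Schur polynomial.

To see that `Ψ` is injective, realize the twisted Heisenberg-Virasoro algebra by two free bosonic
currents, one of which is `I`, on a Fock space; this is possible since `hI ≠ cLI`. The composite of
`Ψ` with the resulting map from the Verma module to the Fock space is surjective: its range contains
the polynomials in the modes of `I`, and those of the other current are then produced by the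
`L (-n)`, again with coefficients that do not vanish. By the Poincaré-Birkhoff-Witt spanning
argument, the eigenspaces of `L 0` on the Verma module of `W(2,2)` are at most as large as those on
the Fock space, so the composite is injective, and so is `Ψ`.

Finally, the recursion `r S_r = ∑_{k ≥ 1} x_k S_{r - k}` gives `L n S_r v = (r - p) S_{r - n} v` for
`n > 0`, which vanishes at `r = p`; that `W n` acts as on a highest weight vector is immediate from
its formula.
-/

section Eigenvectors

theorem eq_of_le_of_iSupIndep {α κ : Type*} [CompleteLattice α] [IsModularLattice α]
    {p q : κ → α} (hp : iSupIndep p) (hle : q ≤ p) (hq : ⨆ k, q k = ⊤) : q = p := by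
  funext k
  have hdisj : p k ⊓ ⨆ j ≠ k, q j = ⊥ :=
    ((hp k).mono_right (iSup₂_mono fun j _ => hle j)).eq_bot
  have hsup : q k ⊔ ⨆ j ≠ k, q j = ⊤ := by rw [← iSup_split_single, hq]
  calc q k = q k ⊔ (⨆ j ≠ k, q j) ⊓ p k := by rw [inf_comm, hdisj, sup_bot_eq]
    _ = (q k ⊔ ⨆ j ≠ k, q j) ⊓ p k := (sup_inf_assoc_of_le _ (hle k)).symm
    _ = p k := by rw [hsup, top_inf_eq]

variable {ι K M N : Type*} [Field K] [AddCommGroup M] [Module K M] [AddCommGroup N] [Module K N]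

theorem span_image_fiber_eq_eigenspace {S : Module.End K N} {a : ι → K} {u : ι → N}
    (hu : ∀ i, S (u i) = a i • u i) (hspan : Submodule.span K (Set.range u) = ⊤) (μ : K) :
    Submodule.span K (u '' (a ⁻¹' {μ})) = S.eigenspace μ := by
  refine congrFun (eq_of_le_of_iSupIndep S.eigenspaces_iSupIndep
    (q := fun μ => Submodule.span K (u '' (a ⁻¹' {μ}))) (fun μ => ?_) ?_) μ
  · rw [Submodule.span_le]
    rintro _ ⟨i, rfl, rfl⟩
    exact Module.End.mem_eigenspace_iff.2 (hu i)
  · rw [← Submodule.span_iUnion, ← Set.image_iUnion, ← Set.preimage_iUnion,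
      Set.iUnion_of_singleton, Set.preimage_univ, Set.image_univ, hspan]

theorem linearIndependent_of_eigenvectors_span {S : Module.End K N} {a : ι → K} {u : ι → N}
    (b : Module.Basis ι K N) (hb : ∀ i, S (b i) = a i • b i) (hfin : ∀ μ, (a ⁻¹' {μ}).Finite)
    (hu : ∀ i, S (u i) = a i • u i) (hspan : Submodule.span K (Set.range u) = ⊤) :
    LinearIndependent K u := by
  have hspanFiber (v : ι → N) (μ : K) :
      Submodule.span K (Set.range fun i : {i // a i = μ} => v i) =
        Submodule.span K (v '' (a ⁻¹' {μ})) := by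
    rw [Set.image_eq_range]; rfl
  have hfiber (μ : K) : LinearIndependent K fun i : {i // a i = μ} => u i := by
    have : Fintype {i // a i = μ} := (hfin μ).fintype
    rw [linearIndependent_iff_card_eq_finrank_span, Set.finrank, hspanFiber,
      span_image_fiber_eq_eigenspace hu hspan, ← span_image_fiber_eq_eigenspace hb b.span_eq,
      ← hspanFiber]
    exact linearIndependent_iff_card_eq_finrank_span.1
      (b.linearIndependent.comp _ Subtype.val_injective)
  have hsigma : LinearIndependent K fun i : Σ μ, {i // a i = μ} => u i.2 := by
    refine linearIndependent_iUnion_finite hfiber fun μ t _ hμ => ?_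
    simp only [hspanFiber, span_image_fiber_eq_eigenspace hu hspan]
    refine (S.eigenspaces_iSupIndep μ).mono_right (iSup₂_mono' fun ν hν => ⟨ν, ?_, le_rfl⟩)
    rintro rfl
    exact hμ hν
  exact (linearIndependent_equiv (Equiv.sigmaFiberEquiv a)).1 hsigma

/-- The eigenspaces of `T` are at most as large as those of `S`, so a surjection that intertwines
`T` and `S` has no room for a kernel. -/
theorem injective_of_surjective_of_eigenvectors {T : Module.End K M} {S : Module.End K N}
    {Φ : M →ₗ[K] N} (hΦ : Function.Surjective Φ) (hTS : ∀ x, Φ (T x) = S (Φ x))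
    {a : ι → K} (hfin : ∀ μ, (a ⁻¹' {μ}).Finite)
    {v : ι → M} (hv : ∀ i, T (v i) = a i • v i) (hspan : Submodule.span K (Set.range v) = ⊤)
    (b : Module.Basis ι K N) (hb : ∀ i, S (b i) = a i • b i) : Function.Injective Φ := by
  have hind : LinearIndependent K (Φ ∘ v) := by
    refine linearIndependent_of_eigenvectors_span b hb hfin
      (fun i => by rw [Function.comp_apply, ← hTS, hv, map_smul]) ?_
    rw [Set.range_comp, Submodule.span_image, hspan, Submodule.map_top,
      LinearMap.range_eq_top.2 hΦ]
  rw [← LinearMap.ker_eq_bot, ← top_disjoint, ← hspan]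
  exact Submodule.range_ker_disjoint hind

end Eigenvectors

theorem finsum_int_eq_of_eq_zero {M : Type*} [AddCommMonoid M] {f : ℤ → M} (m : ℕ)
    (hpos : ∀ i, 0 < i → f i = 0) (hneg : ∀ i, i < -((m : ℤ) + 1) → f i = 0) :
    ∑ᶠ i, f i = f 0 + f (-((m : ℤ) + 1)) + ∑ k ∈ Finset.range m, f (-((k : ℤ) + 1)) := by
  have hsupp : Function.support f ⊆
      ((Finset.range (m + 2)).image fun k : ℕ => -(k : ℤ) : Finset ℤ) := by
    intro i hi
    have hi_le : i ≤ 0 := not_lt.1 fun h => hi (hpos i h)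
    have le_hi : -((m : ℤ) + 1) ≤ i := not_lt.1 fun h => hi (hneg i h)
    simp only [Finset.coe_image, Set.mem_image, Finset.mem_coe, Finset.mem_range]
    exact ⟨(-i).toNat, by omega, by omega⟩
  rw [finsum_eq_sum_of_support_subset f hsupp, Finset.sum_image (fun a _ b _ h => by simpa using h),
    Finset.sum_range_succ, Finset.sum_range_succ']
  simp only [Nat.cast_add, Nat.cast_one, Nat.cast_zero, neg_zero]
  abel

theorem finite_setOf_weight_eq {σ : Type*} {w : σ → ℕ} (hw₀ : ∀ i, w i ≠ 0)
    (hw : ∀ n, {i | w i ≤ n}.Finite) (n : ℕ) : {d : σ →₀ ℕ | Finsupp.weight w d = n}.Finite := by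
  classical
  refine (Set.finite_Icc 0 (Finsupp.indicator (hw n).toFinset fun _ _ => n)).subset fun d hd =>
    ⟨zero_le, fun i => ?_⟩
  rw [Set.mem_ofPred_eq] at hd
  by_cases hi : d i = 0
  · simp [hi]
  · have hwi : w i ≤ n := hd ▸ Finsupp.le_weight_of_ne_zero' w hi
    rw [Finsupp.indicator_of_mem ((hw n).mem_toFinset.2 hwi)]
    exact hd ▸ Finsupp.le_weight w (hw₀ i) d

section Pderiv

open MvPolynomial

variable {σ R : Type*} [CommRing R]

theorem pderiv_pderiv_comm (i j : σ) (f : MvPolynomial σ R) :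
    pderiv i (pderiv j f) = pderiv j (pderiv i f) := by
  have h : ⁅pderiv (R := R) i, pderiv (R := R) j⁆ = 0 := by
    classical
    refine derivation_ext fun k => ?_
    simp only [Derivation.commutator_apply, pderiv_X, Derivation.zero_apply, Pi.single_apply]
    split_ifs <;> simp
  simpa only [Derivation.commutator_apply, Derivation.zero_apply, sub_eq_zero]
    using DFunLike.congr_fun h f

theorem eq_C_of_forall_pderiv_eq_zero [NoZeroDivisors R] [CharZero R] {f : MvPolynomial σ R}
    (hf : ∀ i, pderiv i f = 0) : f = C (constantCoeff f) := by
  classical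
  ext d
  rw [coeff_C]
  split_ifs with hd
  · rw [← hd, constantCoeff_eq]
  · obtain ⟨i, hi⟩ := Finsupp.ne_iff.1 (Ne.symm hd)
    have hcoeff := congrArg (coeff (d - Finsupp.single i 1)) (hf i)
    rw [coeff_pderiv, coeff_zero, tsub_add_cancel_of_le
      (Finsupp.single_le_iff.2 (Nat.one_le_iff_ne_zero.2 hi))] at hcoeff
    exact (mul_eq_zero.1 hcoeff).resolve_right (Nat.cast_add_one_ne_zero _)

end Pderiv

section PBW

open UniversalEnvelopingAlgebra (ι ι_lie)
open Submodule (span)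

variable {J g M : Type*} [LieRing g] [LieAlgebra ℂ g] [AddCommGroup M]
  [Module (UniversalEnvelopingAlgebra ℂ g) M]

theorem ι_smul_ι_smul_eq_add_ι_lie_smul (x y : g) (v : M) :
    ι ℂ x • ι ℂ y • v = ι ℂ y • ι ℂ x • v + ι ℂ ⁅x, y⁆ • v := by
  rw [ι_lie, sub_smul, mul_smul, mul_smul, add_sub_cancel]

variable (x : J → g) (v : M)

/-- The vector `x j₁ ⋯ x jₙ v` for a list `[j₁, …, jₙ]`, the letters of which need not be sorted. -/
noncomputable def pbwWord (l : List J) : M := (l.map fun j => ι ℂ (x j)).prod • v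

theorem pbwWord_nil : pbwWord x v [] = v := by
  rw [pbwWord, List.map_nil, List.prod_nil, one_smul]

theorem pbwWord_cons (j : J) (l : List J) :
    pbwWord x v (j :: l) = ι ℂ (x j) • pbwWord x v l := by
  rw [pbwWord, List.map_cons, List.prod_cons, mul_smul, pbwWord]

variable {x v} [Module ℂ M]

variable (x v) in
/-- The span of the words of length less than `n`. -/
noncomputable def pbwFiltration (n : ℕ) : Submodule ℂ M :=
  span ℂ {w | ∃ l : List J, l.length < n ∧ pbwWord x v l = w}

theorem pbwWord_mem_pbwFiltration {l : List J} {n : ℕ} (hl : l.length < n) :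
    pbwWord x v l ∈ pbwFiltration x v n :=
  Submodule.subset_span ⟨l, hl, rfl⟩

variable [IsScalarTower ℂ (UniversalEnvelopingAlgebra ℂ g) M]

theorem smul_mem_of_forall_ι_smul_mem {S : Submodule ℂ M}
    (hS : ∀ (x : g), ∀ w ∈ S, ι ℂ x • w ∈ S) (u : UniversalEnvelopingAlgebra ℂ g) {w : M}
    (hw : w ∈ S) : u • w ∈ S := by
  let A : Subalgebra ℂ (UniversalEnvelopingAlgebra ℂ g) :=
    { carrier := {u | ∀ w ∈ S, u • w ∈ S}
      mul_mem' := fun ha hb w hw => by rw [mul_smul]; exact ha _ (hb _ hw)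
      add_mem' := fun ha hb w hw => by rw [add_smul]; exact S.add_mem (ha _ hw) (hb _ hw)
      algebraMap_mem' := fun t w hw => by rw [algebraMap_smul]; exact S.smul_mem t hw }
  exact UniversalEnvelopingAlgebra.induction_of_generators A hS u w hw

theorem ι_smul_mem_of_mem_span {S : Submodule ℂ M} {s : Set g} {w : M}
    (hs : ∀ x ∈ s, ι ℂ x • w ∈ S) {y : g} (hy : y ∈ span ℂ s) : ι ℂ y • w ∈ S := by
  induction hy using Submodule.span_induction with
  | mem x hx => exact hs x hx
  | zero => rw [map_zero, zero_smul]; exact S.zero_mem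
  | add x y _ _ hx hy => rw [map_add, add_smul]; exact S.add_mem hx hy
  | smul t x _ hx => rw [map_smul, smul_assoc]; exact S.smul_mem t hx

theorem smul_mem_of_mem_span {S : Submodule ℂ M} {s : Set M} {u : UniversalEnvelopingAlgebra ℂ g}
    (hs : ∀ w ∈ s, u • w ∈ S) {w : M} (hw : w ∈ span ℂ s) : u • w ∈ S :=
  (Submodule.span_le (p := S.comap (Algebra.lsmul ℂ ℂ M u))).2 hs hw

theorem ι_smul_mem_span_pbwWord (hv : ∀ y : g, ι ℂ y • v ∈ span ℂ (Set.range (pbwWord x v))) (y : g)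
    {w : M} (hw : w ∈ span ℂ (Set.range (pbwWord x v))) :
    ι ℂ y • w ∈ span ℂ (Set.range (pbwWord x v)) := by
  refine smul_mem_of_mem_span ?_ hw
  rintro _ ⟨l, rfl⟩
  induction l generalizing y with
  | nil => rw [pbwWord_nil]; exact hv y
  | cons j l ih =>
    rw [pbwWord_cons, ι_smul_ι_smul_eq_add_ι_lie_smul]
    refine add_mem (smul_mem_of_mem_span ?_ (ih y)) (ih _)
    rintro _ ⟨l', rfl⟩
    exact Submodule.subset_span ⟨j :: l', pbwWord_cons x v j l'⟩

theorem span_pbwWord_eq_top (hgen : ∀ w : M, ∃ u : UniversalEnvelopingAlgebra ℂ g, u • v = w)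
    (hv : ∀ y : g, ι ℂ y • v ∈ span ℂ (Set.range (pbwWord x v))) :
    span ℂ (Set.range (pbwWord x v)) = ⊤ := by
  refine (Submodule.eq_top_iff').2 fun w => ?_
  obtain ⟨u, rfl⟩ := hgen w
  exact smul_mem_of_forall_ι_smul_mem (fun y _ => ι_smul_mem_span_pbwWord hv y) u
    (Submodule.subset_span ⟨[], pbwWord_nil x v⟩)

theorem ι_smul_mem_pbwFiltration (j : J) {n : ℕ} {w : M} (hw : w ∈ pbwFiltration x v n) :
    ι ℂ (x j) • w ∈ pbwFiltration x v (n + 1) := by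
  refine smul_mem_of_mem_span ?_ hw
  rintro _ ⟨l, hl, rfl⟩
  rw [← pbwWord_cons]
  exact pbwWord_mem_pbwFiltration (Nat.succ_lt_succ hl)

theorem pbwWord_sub_mem_pbwFiltration (hx : ∀ i j, ⁅x i, x j⁆ ∈ span ℂ (Set.range x))
    {l l' : List J} (hl : l.Perm l') :
    pbwWord x v l - pbwWord x v l' ∈ pbwFiltration x v l.length := by
  induction hl with
  | nil => rw [sub_self]; exact zero_mem _
  | cons i _ ih =>
    rw [pbwWord_cons, pbwWord_cons, ← smul_sub]
    exact ι_smul_mem_pbwFiltration i ih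
  | swap i j l =>
    simp only [pbwWord_cons]
    rw [ι_smul_ι_smul_eq_add_ι_lie_smul, add_sub_cancel_left]
    refine ι_smul_mem_of_mem_span ?_ (hx j i)
    rintro _ ⟨k, rfl⟩
    exact ι_smul_mem_pbwFiltration k (pbwWord_mem_pbwFiltration (Nat.lt_succ_self _))
  | trans h₁ _ ih₁ ih₂ =>
    rw [← h₁.length_eq] at ih₂
    rw [← sub_add_sub_cancel]
    exact add_mem ih₁ ih₂

variable (x v) in
/-- The ordered monomial with exponents `d` in the letters `x`, applied to `v`. The order of the
letters is the one chosen by `Multiset.toList` and depends on `d`; this is harmless, as reordering a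
word only changes it by shorter words. -/
noncomputable def pbwMonomial (d : J →₀ ℕ) : M := pbwWord x v (Finsupp.toMultiset d).toList

theorem span_pbwMonomial_eq_span_pbwWord (hx : ∀ i j, ⁅x i, x j⁆ ∈ span ℂ (Set.range x)) :
    span ℂ (Set.range (pbwMonomial x v)) = span ℂ (Set.range (pbwWord x v)) := by
  refine le_antisymm (Submodule.span_mono ?_) (Submodule.span_le.2 ?_)
  · rintro _ ⟨d, rfl⟩
    exact ⟨_, rfl⟩
  rintro _ ⟨l, rfl⟩
  induction h : l.length using Nat.strong_induction_on generalizing l with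
  | _ n ih =>
    classical
    have hperm : l.Perm (Finsupp.toMultiset (Multiset.toFinsupp (l : Multiset J))).toList := by
      rw [Multiset.toFinsupp_toMultiset, ← Multiset.coe_eq_coe, Multiset.coe_toList]
    have hle : pbwFiltration x v l.length ≤ span ℂ (Set.range (pbwMonomial x v)) := by
      refine Submodule.span_le.2 ?_
      rintro _ ⟨l', hl', rfl⟩
      exact ih l'.length (h ▸ hl') l' rfl
    rw [← sub_add_cancel (pbwWord x v l)]
    exact add_mem (hle (pbwWord_sub_mem_pbwFiltration hx hperm)) (Submodule.subset_span ⟨_, rfl⟩)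

variable {y : g} {a : J → ℕ} {c : ℂ}

theorem ι_smul_pbwWord (hy : ∀ j, ⁅y, x j⁆ = (a j : ℂ) • x j) (hv : ι ℂ y • v = c • v)
    (l : List J) : ι ℂ y • pbwWord x v l = (c + (l.map a).sum) • pbwWord x v l := by
  induction l with
  | nil => rw [pbwWord_nil, hv, List.map_nil, List.sum_nil, Nat.cast_zero, add_zero]
  | cons j l ih =>
    rw [pbwWord_cons, ι_smul_ι_smul_eq_add_ι_lie_smul, ih, hy, map_smul, smul_assoc, smul_comm,
      ← add_smul, List.map_cons, List.sum_cons]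
    congr 1
    push_cast
    ring

theorem ι_smul_pbwMonomial (hy : ∀ j, ⁅y, x j⁆ = (a j : ℂ) • x j) (hv : ι ℂ y • v = c • v)
    (d : J →₀ ℕ) :
    ι ℂ y • pbwMonomial x v d = (c + (Finsupp.weight a d : ℕ)) • pbwMonomial x v d := by
  have hsum : (((Finsupp.toMultiset d).toList).map a).sum = Finsupp.weight a d := by
    rw [← Multiset.sum_coe, ← Multiset.map_coe, Multiset.coe_toList, Finsupp.toMultiset_map,
      Finsupp.sum_toMultiset, Finsupp.sum_mapDomain_index (by simp) (fun _ _ _ => add_smul _ _ _),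
      Finsupp.weight_apply]
  rw [pbwMonomial, ι_smul_pbwWord hy hv, hsum]

end PBW

namespace W22

open UniversalEnvelopingAlgebra (ι)
open Submodule (span)

variable {cL cW h hW : ℂ}

theorem smul_hwv (u : U) : u • hwv cL cW h hW = Submodule.Quotient.mk u := by
  rw [hwv, ← Submodule.Quotient.mk_smul, smul_eq_mul, mul_one]

theorem smul_hwv_eq_zero {u : U} (hu : VermaRel cL cW h hW u) : u • hwv cL cW h hW = 0 := by
  rw [smul_hwv]
  exact (Submodule.Quotient.mk_eq_zero _).2 (Submodule.subset_span hu)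

theorem smul_hwv_eq_smul {u : U} {a : ℂ} (hu : VermaRel cL cW h hW (u - algebraMap ℂ U a)) :
    u • hwv cL cW h hW = a • hwv cL cW h hW := by
  simpa only [sub_smul, sub_eq_zero, algebraMap_smul] using smul_hwv_eq_zero hu

theorem lie_e (i j : W22Basis) : ⁅e i, e j⁆ = (W22Basis.br i j : W22Basis →₀ ℂ) :=
  StructureConstants.bracket_single _ i j

theorem single_eq_smul_e (i : W22Basis) (t : ℂ) : (Finsupp.single i t : W22) = t • e i :=
  (Finsupp.smul_single_one i t).symm

theorem span_range_e : span ℂ (Set.range e) = ⊤ :=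
  (Finsupp.basisSingleOne (R := ℂ) (ι := W22Basis)).span_eq

/-- The basis elements of negative degree: `(true, m)` stands for `W (-(m + 1))` and `(false, m)`
for `L (-(m + 1))`. -/
noncomputable def negMode : Bool × ℕ → W22
  | (true, m) => e (.W (-((m : ℤ) + 1)))
  | (false, m) => e (.L (-((m : ℤ) + 1)))

theorem lie_negMode_mem_span (i j : Bool × ℕ) :
    ⁅negMode i, negMode j⁆ ∈ span ℂ (Set.range negMode) := by
  have hmode (a b : ℕ) : -((a : ℤ) + 1) + -((b : ℤ) + 1) = -(((a + b + 1 : ℕ) : ℤ) + 1) := by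
    push_cast
    ring
  have hne (a b : ℕ) : ¬ -((a : ℤ) + 1) = - -((b : ℤ) + 1) := by omega
  have hsingle {k : W22Basis} {l : Bool × ℕ} (hk : negMode l = e k) (t : ℂ) :
      (Finsupp.single k t : W22) ∈ span ℂ (Set.range negMode) := by
    rw [single_eq_smul_e]
    exact (span ℂ (Set.range negMode)).smul_mem t (Submodule.subset_span ⟨l, hk⟩)
  rcases i with ⟨_ | _, a⟩ <;> rcases j with ⟨_ | _, b⟩ <;>
    simp only [negMode, lie_e, W22Basis.br, if_neg (hne _ _), Finsupp.single_zero, add_zero, hmode]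
  · exact hsingle (l := (false, a + b + 1)) rfl _
  · exact hsingle (l := (true, a + b + 1)) rfl _
  · exact neg_mem (hsingle (l := (true, b + a + 1)) rfl _)
  · exact zero_mem _

theorem lie_L_zero_negMode (i : Bool × ℕ) :
    ⁅e (.L 0), negMode i⁆ = ((i.2 + 1 : ℕ) : ℂ) • negMode i := by
  rcases i with ⟨_ | _, m⟩ <;> simp only [negMode, lie_e, W22Basis.br] <;>
  · rw [if_neg (by omega), Finsupp.single_zero, add_zero, zero_add]
    refine (single_eq_smul_e _ _).trans ?_
    congr 1
    push_cast
    ring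

theorem ι_e_smul_hwv_mem {S : Submodule ℂ (Verma cL cW h hW)} (hS₀ : hwv cL cW h hW ∈ S)
    (hS : ∀ i, ι ℂ (negMode i) • hwv cL cW h hW ∈ S) (j : W22Basis) :
    ι ℂ (e j) • hwv cL cW h hW ∈ S := by
  have hscalar {u : U} {a : ℂ} (hu : VermaRel cL cW h hW (u - algebraMap ℂ U a)) :
      u • hwv cL cW h hW ∈ S := by
    rw [smul_hwv_eq_smul hu]
    exact S.smul_mem a hS₀
  have hzero {u : U} (hu : VermaRel cL cW h hW u) : u • hwv cL cW h hW ∈ S := by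
    rw [smul_hwv_eq_zero hu]
    exact S.zero_mem
  have hneg {n : ℤ} (hn : n < 0) : ∃ m : ℕ, n = -((m : ℤ) + 1) := ⟨(-n - 1).toNat, by omega⟩
  rcases j with n | n | _ | _
  · rcases lt_trichotomy n 0 with hn | rfl | hn
    · obtain ⟨m, rfl⟩ := hneg hn
      exact hS (false, m)
    · exact hscalar .L_zero
    · exact hzero (.L_pos n hn)
  · rcases lt_trichotomy n 0 with hn | rfl | hn
    · obtain ⟨m, rfl⟩ := hneg hn
      exact hS (true, m)
    · exact hscalar .W_zero
    · exact hzero (.W_pos n hn)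
  · exact hscalar .C
  · exact hscalar .CW

theorem span_pbwMonomial_eq_top :
    span ℂ (Set.range (pbwMonomial negMode (hwv cL cW h hW))) = ⊤ := by
  rw [span_pbwMonomial_eq_span_pbwWord lie_negMode_mem_span]
  refine span_pbwWord_eq_top (fun w => ?_) fun y => ?_
  · induction w using Submodule.Quotient.induction_on with
    | H u => exact ⟨u, smul_hwv u⟩
  · refine ι_smul_mem_of_mem_span (s := Set.range e) ?_
      (by rw [span_range_e]; exact Submodule.mem_top)
    rintro _ ⟨j, rfl⟩
    refine ι_e_smul_hwv_mem (S := span ℂ (Set.range (pbwWord negMode (hwv cL cW h hW))))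
      (Submodule.subset_span ⟨[], pbwWord_nil _ _⟩) (fun i => Submodule.subset_span ⟨[i], ?_⟩) j
    rw [pbwWord_cons, pbwWord_nil]

theorem L_zero_smul_pbwMonomial (d : Bool × ℕ →₀ ℕ) :
    L 0 • pbwMonomial negMode (hwv cL cW h hW) d =
      (h + (Finsupp.weight (fun i : Bool × ℕ => i.2 + 1) d : ℕ)) •
        pbwMonomial negMode (hwv cL cW h hW) d :=
  ι_smul_pbwMonomial lie_L_zero_negMode (smul_hwv_eq_smul .L_zero) d

end W22

section HighestWeight

variable {V : Type*} [AddCommGroup V] [Module ℂ V]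

/-- The vectors that generate a highest weight module of weight `a` under the Heisenberg modes
`I n`: the positive modes annihilate them and `I 0` acts on them by `a`. -/
def heisenbergVacua (I : ℤ → Module.End ℂ V) (a : ℂ) : Submodule ℂ V where
  carrier := {x | (∀ k : ℤ, 0 < k → I k x = 0) ∧ I 0 x = a • x}
  zero_mem' := ⟨fun k _ => map_zero _, by rw [map_zero, smul_zero]⟩
  add_mem' hx hy := ⟨fun k hk => by rw [map_add, hx.1 k hk, hy.1 k hk, add_zero],
    by rw [map_add, smul_add, hx.2, hy.2]⟩
  smul_mem' t x hx := ⟨fun k hk => by rw [map_smul, hx.1 k hk, smul_zero],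
    by rw [map_smul, hx.2, smul_comm]⟩

/-- Highest weight vectors of weight `(h, hI)` for operators `L n`, `I n` as in
`IsLevelZeroRep`. -/
structure IsHighestWeightVector (L I : ℤ → Module.End ℂ V) (h hI : ℂ) (v : V) : Prop where
  L_pos : ∀ n : ℤ, 0 < n → L n v = 0
  L_zero : L 0 v = h • v
  mem_vacua : v ∈ heisenbergVacua I hI

end HighestWeight

namespace IsLevelZeroRep

variable {V : Type*} [AddCommGroup V] [Module ℂ V] {L I : ℤ → Module.End ℂ V} {cL cLI : ℂ}
  (H : IsLevelZeroRep L I cL cLI)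

section Vacua

variable {a : ℂ} {x : V} (hx : x ∈ heisenbergVacua I a)
include H hx

theorem I_mem_heisenbergVacua (n : ℤ) : I n x ∈ heisenbergVacua I a :=
  ⟨fun k hk => by rw [H.II, hx.1 k hk, map_zero], by rw [H.II, hx.2, map_smul]⟩

theorem wMode_eq_zero_of_pos {n : ℤ} (hn : 0 < n) : H.wMode n x = 0 := by
  rw [wMode_apply, hx.1 n hn, smul_zero, sub_zero, finsum_eq_zero_of_forall_eq_zero]
  intro i
  rcases lt_or_ge 0 i with hi | hi
  · exact (H.I_mem_heisenbergVacua hx _).1 i hi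
  · rw [hx.1 (n - i) (by omega), map_zero]

theorem wMode_zero_eq_smul : H.wMode 0 x = (a * (a - 2 * cLI)) • x := by
  rw [wMode_apply, finsum_eq_single _ 0 fun i hi => ?_]
  · rw [sub_zero, hx.2, map_smul, hx.2, Int.cast_zero]
    module
  · rcases lt_or_gt_of_ne hi with hi | hi
    · rw [hx.1 (0 - i) (by omega), map_zero]
    · exact (H.I_mem_heisenbergVacua hx _).1 i hi

theorem wMode_neg_eq (m : ℕ) : H.wMode (-((m : ℤ) + 1)) x =
    (2 * (a + cLI * m)) • I (-((m : ℤ) + 1)) x +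
      ∑ k ∈ Finset.range m, I (-((k : ℤ) + 1)) (I (k - m) x) := by
  have hIx := H.I_mem_heisenbergVacua hx
  have hsum : ∑ᶠ i : ℤ, I i (I (-((m : ℤ) + 1) - i) x) =
      (2 * a) • I (-((m : ℤ) + 1)) x +
        ∑ k ∈ Finset.range m, I (-((k : ℤ) + 1)) (I (k - m) x) := by
    rw [finsum_int_eq_of_eq_zero m (fun i hi => (hIx _).1 i hi)
      fun i hi => by rw [hx.1 _ (by omega), map_zero]]
    simp only [sub_zero, sub_self, hx.2, (hIx _).2, map_smul, two_mul, add_smul]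
    congr! 5
    ring
  rw [wMode_apply, hsum]
  push_cast
  module

end Vacua

section Verma

/-- The action of the basis elements of the twisted Heisenberg-Virasoro algebra by the operators
`L n`, `I n` and by the scalars `C_L = cL`, `C_LI = cLI`, `C_I = 0`. -/
noncomputable def hvirBasis (_ : IsLevelZeroRep L I cL cLI) : HVirBasis → Module.End ℂ V
  | .L n => L n
  | .I n => I n
  | .CL => cL • 1
  | .CLI => cLI • 1
  | .CI => 0

theorem hvirBasis_br (i j : HVirBasis) :
    Finsupp.linearCombination ℂ H.hvirBasis (HVirBasis.br i j) =
      H.hvirBasis i * H.hvirBasis j - H.hvirBasis j * H.hvirBasis i := by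
  rcases i with n | n | _ | _ | _ <;> rcases j with m | m | _ | _ | _ <;>
    ext x <;>
    simp only [HVirBasis.br, hvirBasis, map_add, map_sub, map_neg, map_zero,
      Finsupp.linearCombination_single, LinearMap.add_apply, LinearMap.sub_apply,
      LinearMap.neg_apply, LinearMap.smul_apply, LinearMap.zero_apply, Module.End.mul_apply,
      Module.End.one_apply, map_smul, sub_self, smul_zero]
  · rw [H.LL n m x, ← ite_zero_mul]
    module
  · rw [H.LI n m x, ← ite_zero_mul]
    module
  · rw [H.LI m n x, ← ite_zero_mul]
    module
  · rw [H.II n m x, sub_self]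
  · rw [smul_comm, sub_self]
  · rw [smul_comm, sub_self]

section Lift

attribute [local instance 100] LieRing.ofAssociativeRing

/-- The representation of the twisted Heisenberg-Virasoro algebra on `V` by the operators `L n`,
`I n`. -/
noncomputable def hvirRep : HVir →ₗ⁅ℂ⁆ Module.End ℂ V where
  toFun x := Finsupp.linearCombination ℂ H.hvirBasis x
  map_add' x y := map_add (Finsupp.linearCombination ℂ H.hvirBasis) x y
  map_smul' t x := map_smul (Finsupp.linearCombination ℂ H.hvirBasis) t x
  map_lie' {x y} :=
    StructureConstants.linearCombination_bracket HVirBasis.br H.hvirBasis H.hvirBasis_br x y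

/-- The resulting action of the enveloping algebra on `V`. -/
noncomputable def hvirAction : HVir.U →ₐ[ℂ] Module.End ℂ V :=
  UniversalEnvelopingAlgebra.lift ℂ H.hvirRep

theorem hvirAction_e (i : HVirBasis) :
    H.hvirAction (UniversalEnvelopingAlgebra.ι ℂ (HVir.e i)) = H.hvirBasis i := by
  rw [hvirAction, UniversalEnvelopingAlgebra.lift_ι_apply]
  change Finsupp.linearCombination ℂ H.hvirBasis (Finsupp.single i 1) = _
  rw [Finsupp.linearCombination_single, one_smul]

end Lift

variable {h hI : ℂ} {v : V} (hv : IsHighestWeightVector L I h hI v)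

include hv in
theorem hvirAction_apply_eq_zero_of_vermaRel {u : HVir.U} (hu : HVir.VermaRel cL 0 cLI h hI u) :
    H.hvirAction u v = 0 := by
  cases hu with
  | L_pos n hn => rw [HVir.L, hvirAction_e]; exact hv.L_pos n hn
  | I_pos n hn => rw [HVir.I, hvirAction_e]; exact hv.mem_vacua.1 n hn
  | L_zero =>
    rw [map_sub, HVir.L, hvirAction_e, AlgHom.commutes, LinearMap.sub_apply, sub_eq_zero]
    exact hv.L_zero
  | I_zero =>
    rw [map_sub, HVir.I, hvirAction_e, AlgHom.commutes, LinearMap.sub_apply, sub_eq_zero]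
    exact hv.mem_vacua.2
  | CL => rw [map_sub, HVir.CL, hvirAction_e, AlgHom.commutes]; exact sub_self (cL • v)
  | CI => rw [map_sub, HVir.CI, hvirAction_e, map_zero, map_zero]; exact sub_self (0 : V)
  | CLI => rw [map_sub, HVir.CLI, hvirAction_e, AlgHom.commutes]; exact sub_self (cLI • v)

/-- The homomorphism from the Verma module that sends its highest weight vector to `v`. -/
noncomputable def ofVerma : HVir.Verma cL 0 cLI h hI →ₗ[ℂ] V :=
  (((HVir.vermaIdeal cL 0 cLI h hI).restrictScalars ℂ).liftQ
    ((LinearMap.applyₗ v).comp H.hvirAction.toLinearMap) fun u hu => by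
      induction hu using Submodule.span_induction with
      | mem u hu => exact H.hvirAction_apply_eq_zero_of_vermaRel hv hu
      | zero => exact zero_mem _
      | add _ _ _ _ hx hy => exact add_mem hx hy
      | smul a u _ hu =>
        rw [LinearMap.mem_ker] at hu ⊢
        change H.hvirAction (a * u) v = 0
        rw [map_mul, Module.End.mul_apply]
        exact (congrArg (H.hvirAction a) hu).trans (map_zero _)).comp
    (Submodule.Quotient.restrictScalarsEquiv ℂ (HVir.vermaIdeal cL 0 cLI h hI)).symm.toLinearMap

theorem ofVerma_mk (u : HVir.U) : H.ofVerma hv (Submodule.Quotient.mk u) = H.hvirAction u v := rfl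

theorem ofVerma_hwv : H.ofVerma hv (HVir.hwv cL 0 cLI h hI) = v := by
  rw [HVir.hwv, ofVerma_mk, map_one, Module.End.one_apply]

theorem ofVerma_smul (u : HVir.U) (x : HVir.Verma cL 0 cLI h hI) :
    H.ofVerma hv (u • x) = H.hvirAction u (H.ofVerma hv x) := by
  induction x using Submodule.Quotient.induction_on with
  | H y =>
    rw [← Submodule.Quotient.mk_smul, smul_eq_mul, ofVerma_mk, ofVerma_mk, map_mul,
      Module.End.mul_apply]

theorem ofVerma_L (n : ℤ) (x : HVir.Verma cL 0 cLI h hI) :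
    H.ofVerma hv (HVir.opL cL 0 cLI h hI n x) = L n (H.ofVerma hv x) := by
  refine (H.ofVerma_smul hv (HVir.L n) x).trans ?_
  rw [HVir.L, hvirAction_e]
  rfl

theorem ofVerma_I (n : ℤ) (x : HVir.Verma cL 0 cLI h hI) :
    H.ofVerma hv (HVir.opI cL 0 cLI h hI n x) = I n (H.ofVerma hv x) := by
  refine (H.ofVerma_smul hv (HVir.I n) x).trans ?_
  rw [HVir.I, hvirAction_e]
  rfl

end Verma

end IsLevelZeroRep

theorem HVir.isHighestWeightVector_hwv (cL cI cLI h hI : ℂ) :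
    IsHighestWeightVector (opL cL cI cLI h hI) (opI cL cI cLI h hI) h hI (hwv cL cI cLI h hI) where
  L_pos _ hn := smul_hwv_eq_zero (.L_pos _ hn)
  L_zero := smul_hwv_eq_smul .L_zero
  mem_vacua := ⟨fun _ hk => smul_hwv_eq_zero (.I_pos _ hk), smul_hwv_eq_smul .I_zero⟩

section SchurPolynomials

theorem schurPoly_zero : schurPoly 0 = 1 := by
  have h0 : PowerSeries.constantCoeff schurExponent = 0 := by
    rw [← PowerSeries.coeff_zero_eq_constantCoeff_apply, schurExponent, PowerSeries.coeff_mk,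
      if_pos rfl]
  rw [schurPoly, PowerSeries.coeff_subst' hasSubst_schurExponent, finsum_eq_single _ 0]
  · simp
  · intro d hd
    rw [PowerSeries.coeff_zero_eq_constantCoeff_apply, map_pow, h0, zero_pow hd, smul_zero]

theorem coeff_derivative_schurExponent (k : ℕ) :
    PowerSeries.coeff k (PowerSeries.derivative (MvPolynomial ℕ ℂ) schurExponent) =
      MvPolynomial.X (k + 1) := by
  have hk : (k : MvPolynomial ℕ ℂ) + 1 = MvPolynomial.C ((k + 1 : ℕ) : ℂ) := by simp
  rw [PowerSeries.coeff_derivative, schurExponent, PowerSeries.coeff_mk, if_neg k.succ_ne_zero,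
    hk, mul_right_comm, ← map_mul, one_div_mul_cancel (Nat.cast_ne_zero.2 k.succ_ne_zero), map_one,
    one_mul]

theorem natCast_mul_schurPoly (r : ℕ) : (r : MvPolynomial ℕ ℂ) * schurPoly r =
    ∑ k ∈ Finset.range r, MvPolynomial.X (k + 1) * schurPoly (r - 1 - k) := by
  rcases r with _ | r
  · rw [Nat.cast_zero, zero_mul, Finset.sum_range_zero]
  -- Compare the coefficients in `(exp f)' = f' * exp f`.
  have h := congrArg (PowerSeries.coeff r) (PowerSeries.derivative_subst
    (f := PowerSeries.exp (MvPolynomial ℕ ℂ)) hasSubst_schurExponent)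
  rw [PowerSeries.derivative_exp, PowerSeries.coeff_derivative,
    mul_comm (PowerSeries.subst _ _) (PowerSeries.derivative _ _),
    PowerSeries.coeff_mul, Finset.Nat.sum_antidiagonal_eq_sum_range_succ_mk] at h
  simp only [coeff_derivative_schurExponent] at h
  rw [schurPoly, mul_comm, Nat.cast_succ, h]
  rfl

end SchurPolynomials

section SchurSequences

variable {V : Type*} [AddCommGroup V] [Module ℂ V]

theorem sum_smul_I_sub_apply {I : ℤ → Module.End ℂ V} {hI : ℂ} {S : ℤ → V}
    (hS : ∀ r, S r ∈ heisenbergVacua I hI) (a M : ℕ) (r : ℤ) :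
    ∑ k ∈ Finset.range (a + 1 + M), ((k : ℂ) + 1) • I (a - k) (S (r - (k + 1))) =
      (((a : ℂ) + 1) * hI) • S (r - (a + 1)) + ∑ k ∈ Finset.range M,
        ((a : ℂ) + k + 2) • I (-((k : ℤ) + 1)) (S (r - (a + 1) - (k + 1))) := by
  rw [Finset.sum_range_add, Finset.sum_range_succ, Finset.sum_eq_zero fun k hk => ?_, zero_add,
    sub_self, (hS _).2, smul_smul]
  · congr 1
    refine Finset.sum_congr rfl fun k _ => ?_
    rw [show (a : ℤ) - (a + 1 + k : ℕ) = -((k : ℤ) + 1) by push_cast; ring,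
      show r - ((a + 1 + k : ℕ) + 1) = r - (a + 1) - (k + 1) by push_cast; ring]
    push_cast
    congr 1
    ring
  · rw [(hS _).1 _ (sub_pos.2 (Nat.cast_lt.2 (Finset.mem_range.1 hk))), smul_zero]

/-- The recursion satisfied by the vectors `S r = S_r(-I(-1)/c, -I(-2)/c, …) v`. The sequence is
indexed by `ℤ` and vanishes at negative indices, so that any sufficiently large `N` can be used as
the upper limit of the sum. -/
structure IsSchurSequence (I : ℤ → Module.End ℂ V) (c : ℂ) (S : ℤ → V) : Prop where
  eq_zero_of_neg : ∀ r : ℤ, r < 0 → S r = 0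
  sum_eq : ∀ (N : ℕ) (r : ℤ), r ≤ N →
    ∑ k ∈ Finset.range N, I (-((k : ℤ) + 1)) (S (r - (k + 1))) = (-(c * r)) • S r

namespace IsSchurSequence

variable {I : ℤ → Module.End ℂ V} {c : ℂ} {S : ℤ → V} (hS : IsSchurSequence I c S)
include hS

theorem mem_of_mem_zero (hc : c ≠ 0) {P : Submodule ℂ V} (h0 : S 0 ∈ P)
    (hP : ∀ k : ℕ, ∀ x ∈ P, I (-((k : ℤ) + 1)) x ∈ P) (r : ℤ) : S r ∈ P := by
  induction r using Int.strongRec (m := 1) with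
  | lt r hr =>
    obtain hr | rfl : r < 0 ∨ r = 0 := by omega
    · rw [hS.eq_zero_of_neg r hr]
      exact zero_mem P
    · exact h0
  | ge r hr ih =>
    have hcr : -(c * r) ≠ 0 := neg_ne_zero.2 (mul_ne_zero hc (Int.cast_ne_zero.2 (by omega)))
    rw [← P.smul_mem_iff hcr, ← hS.sum_eq r.toNat r (by omega)]
    exact P.sum_mem fun k _ => hP k _ (ih _ (by omega))

variable {L : ℤ → Module.End ℂ V} {cL h hI p : ℂ} (H : IsLevelZeroRep L I cL c)
include H

theorem mem_heisenbergVacua (hc : c ≠ 0) (h0 : S 0 ∈ heisenbergVacua I hI) (r : ℤ) :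
    S r ∈ heisenbergVacua I hI :=
  hS.mem_of_mem_zero hc h0 (fun _ _ hx => H.I_mem_heisenbergVacua hx _) r

theorem L_zero_apply (hc : c ≠ 0) (h0 : L 0 (S 0) = h • S 0) (r : ℤ) :
    L 0 (S r) = (h + r) • S r := by
  induction r using Int.strongRec (m := 1) with
  | lt r hr =>
    obtain hr | rfl : r < 0 ∨ r = 0 := by omega
    · rw [hS.eq_zero_of_neg r hr, map_zero, smul_zero]
    · rw [h0, Int.cast_zero, add_zero]
  | ge r hr ih =>
    have hcr : -(c * r) ≠ 0 := neg_ne_zero.2 (mul_ne_zero hc (Int.cast_ne_zero.2 (by omega)))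
    refine smul_right_injective V hcr ?_
    change (-(c * r)) • L 0 (S r) = (-(c * r)) • (h + r) • S r
    rw [← map_smul, smul_comm _ (h + (r : ℂ)), ← hS.sum_eq r.toNat r (by omega), map_sum,
      Finset.smul_sum]
    refine Finset.sum_congr rfl fun k _ => ?_
    rw [H.LI, ih _ (by omega), if_neg (by omega), zero_smul, sub_zero, zero_add, map_smul,
      ← add_smul]
    push_cast
    congr 1
    ring

theorem smul_L_pos_apply (hvac : ∀ r, S r ∈ heisenbergVacua I hI) (a : ℕ) {M : ℕ} {r : ℤ}
    (hr : r ≤ M) : (-(c * r)) • L ((a : ℤ) + 1) (S r) =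
      ∑ k ∈ Finset.range (a + 1 + M), I (-((k : ℤ) + 1)) (L ((a : ℤ) + 1) (S (r - (k + 1)))) +
      ((((a : ℂ) + 1) * hI) • S (r - (a + 1)) + ∑ k ∈ Finset.range M,
        ((a : ℂ) + k + 2) • I (-((k : ℤ) + 1)) (S (r - (a + 1) - (k + 1)))) -
      (((a : ℂ) + 1) * (a + 2) * c) • S (r - (a + 1)) := by
  have hshift (k : ℕ) (x : V) : (-((-((k : ℤ) + 1) : ℤ) : ℂ)) •
      I ((a : ℤ) + 1 + -((k : ℤ) + 1)) x = ((k : ℂ) + 1) • I (a - k) x := by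
    rw [show (a : ℤ) + 1 + -((k : ℤ) + 1) = a - k by ring]
    push_cast
    rw [neg_neg]
  have hcentral : ∑ k ∈ Finset.range (a + 1 + M),
      (if (a : ℤ) + 1 = -(-((k : ℤ) + 1)) then (((a + 1 : ℤ) : ℂ) ^ 2 + (a + 1 : ℤ)) * c else 0) •
        S (r - (k + 1)) = (((a : ℂ) + 1) * (a + 2) * c) • S (r - (a + 1)) := by
    rw [Finset.sum_eq_single_of_mem a (Finset.mem_range.2 (by omega)) fun k _ hk => by
      rw [if_neg (by omega), zero_smul], if_pos (by omega)]
    push_cast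
    congr 1
    ring
  rw [← map_smul, ← hS.sum_eq (a + 1 + M) r (by omega), map_sum]
  simp only [H.LI, Finset.sum_sub_distrib, Finset.sum_add_distrib, hshift]
  rw [hcentral, sum_smul_I_sub_apply hvac]

theorem L_pos_apply (hc : c ≠ 0) (hv : IsHighestWeightVector L I h hI (S 0))
    (hp : hI = (p + 1) * c) (a : ℕ) (r : ℤ) :
    L ((a : ℤ) + 1) (S r) = (r - p) • S (r - (a + 1)) := by
  induction r using Int.strongRec (m := 1) with
  | lt r hr =>
    rw [hS.eq_zero_of_neg (r - (a + 1)) (by omega), smul_zero]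
    obtain hr | rfl : r < 0 ∨ r = 0 := by omega
    · rw [hS.eq_zero_of_neg r hr, map_zero]
    · exact hv.L_pos _ (by omega)
  | ge r hr ih =>
    have hcr : -(c * r) ≠ 0 := neg_ne_zero.2 (mul_ne_zero hc (Int.cast_ne_zero.2 (by omega)))
    obtain ⟨M, rfl⟩ : ∃ M : ℕ, r = M := ⟨r.toNat, by omega⟩
    have hind : ∑ k ∈ Finset.range (a + 1 + M),
        I (-((k : ℤ) + 1)) (L ((a : ℤ) + 1) (S (M - (k + 1)))) =
        ∑ k ∈ Finset.range M, ((M : ℂ) - (k + 1) - p) •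
          I (-((k : ℤ) + 1)) (S (M - (a + 1) - (k + 1))) := by
      rw [Finset.eventually_constant_sum (N := M) (fun k hk => by
        rw [hS.eq_zero_of_neg _ (by omega), map_zero, map_zero]) (by omega)]
      refine Finset.sum_congr rfl fun k _ => ?_
      rw [ih _ (by omega), map_smul, sub_right_comm]
      push_cast
      rfl
    have hcombine : ∑ k ∈ Finset.range M, ((M : ℂ) - (k + 1) - p) •
          I (-((k : ℤ) + 1)) (S (M - (a + 1) - (k + 1))) + ∑ k ∈ Finset.range M,
          ((a : ℂ) + k + 2) • I (-((k : ℤ) + 1)) (S (M - (a + 1) - (k + 1))) =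
        (M + a + 1 - p) • (-(c * (M - (a + 1)))) • S (M - (a + 1)) := by
      have hsum := hS.sum_eq M (M - (a + 1)) (by omega)
      push_cast at hsum
      rw [← hsum, Finset.smul_sum, ← Finset.sum_add_distrib]
      refine Finset.sum_congr rfl fun k _ => ?_
      rw [← add_smul]
      congr 1
      ring
    refine smul_right_injective V hcr ((hS.smul_L_pos_apply H
      (hS.mem_heisenbergVacua H hc hv.mem_vacua) a le_rfl).trans ?_)
    rw [hind, add_left_comm, hcombine, hp]
    push_cast
    module

end IsSchurSequence

end SchurSequences

namespace HVir

variable {cL cLI h hI : ℂ}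

theorem schurVector_zero : schurVector cL 0 cLI h hI 0 = hwv cL 0 cLI h hI := by
  rw [schurVector, schurPoly_zero, map_one, one_smul]

theorem natCast_smul_schurVector (r : ℕ) : (r : ℂ) • schurVector cL 0 cLI h hI r =
    -(1 / cLI) • ∑ k ∈ Finset.range r,
      opI cL 0 cLI h hI (-((k : ℤ) + 1)) (schurVector cL 0 cLI h hI (r - 1 - k)) := by
  unfold schurVector
  generalize_proofs _ ha
  have h := congrArg (fun q => evalCommuting _ ha q • hwv cL 0 cLI h hI) (natCast_mul_schurPoly r)
  simp only [map_mul, map_sum, map_natCast, evalCommuting_X, Finset.sum_smul, mul_smul,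
    Nat.cast_smul_eq_nsmul] at h
  rw [Nat.cast_smul_eq_nsmul, h, Finset.smul_sum]
  refine Finset.sum_congr rfl fun k _ => ?_
  rw [← neg_smul, smul_assoc]
  push_cast
  rfl

theorem isSchurSequence_schurVector (hcLI : cLI ≠ 0) :
    IsSchurSequence (opI cL 0 cLI h hI) cLI
      fun r : ℤ => if r < 0 then 0 else schurVector cL 0 cLI h hI r.toNat where
  eq_zero_of_neg _ hr := if_pos hr
  sum_eq N r hrN := by
    rcases lt_or_ge r 0 with hr | hr
    · rw [if_pos hr, smul_zero, Finset.sum_eq_zero fun k _ => ?_]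
      rw [if_pos (by omega), map_zero]
    obtain ⟨n, rfl⟩ := Int.eq_ofNat_of_zero_le hr
    rw [Finset.eventually_constant_sum (N := n) (fun k hk => by
        rw [if_pos (by omega), map_zero]) (by omega), if_neg (by omega), Int.cast_natCast,
      Int.toNat_natCast, neg_smul, mul_smul, natCast_smul_schurVector, smul_smul, ← neg_smul,
      mul_neg, neg_neg, mul_one_div_cancel hcLI, one_smul]
    refine Finset.sum_congr rfl fun k hk => ?_
    rw [Finset.mem_range] at hk
    rw [if_neg (by omega), show ((n : ℤ) - (k + 1)).toNat = n - 1 - k by omega]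

end HVir

/-- The Fock space of two free bosonic currents `J s` for `s : Bool`, with
`[J s n, J t m] = n δ_{s, !t} δ_{n, -m}`: the variable `X (s, m)` stands for `J s (-(m + 1))`. -/
abbrev Fock : Type := MvPolynomial (Bool × ℕ) ℂ

namespace Fock

open MvPolynomial

section Current

/-- The mode `n` of the current `J s` on the Fock space, with zero mode `z s`. -/
noncomputable def current (z : Bool → ℂ) (s : Bool) : ℤ → Module.End ℂ Fock
  | .negSucc m => LinearMap.mulLeft ℂ (X (s, m))
  | .ofNat 0 => z s • 1
  | .ofNat (m + 1) => ((m : ℂ) + 1) • (pderiv (!s, m)).toLinearMap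

variable (z : Bool → ℂ)

theorem current_neg (s : Bool) (m : ℕ) (f : Fock) :
    current z s (-((m : ℤ) + 1)) f = X (s, m) * f := by
  rw [← Int.negSucc_eq]
  rfl

theorem current_zero (s : Bool) (f : Fock) : current z s 0 f = z s • f := rfl

theorem current_pos (s : Bool) (m : ℕ) (f : Fock) :
    current z s ((m : ℤ) + 1) f = ((m : ℂ) + 1) • pderiv (!s, m) f := rfl

@[elab_as_elim]
theorem mode_cases {P : ℤ → Prop} (neg : ∀ m : ℕ, P (-((m : ℤ) + 1))) (zero : P 0)
    (pos : ∀ m : ℕ, P ((m : ℤ) + 1)) (n : ℤ) : P n := by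
  rcases lt_trichotomy n 0 with h | rfl | h
  · convert neg (-n - 1).toNat using 1
    omega
  · exact zero
  · convert pos (n - 1).toNat using 1
    omega

theorem pderiv_X_mul (s t : Bool) (a b : ℕ) (f : Fock) : pderiv (!s, a) (X (t, b) * f) =
    X (t, b) * pderiv (!s, a) f + if s = !t ∧ a = b then f else 0 := by
  classical
  rw [pderiv_mul, pderiv_X, Pi.single_apply, add_comm]
  congr 1
  simp only [Prod.mk.injEq]
  cases s <;> cases t <;> grind

theorem current_comm (s t : Bool) (n m : ℤ) (f : Fock) :
    current z s n (current z t m f) = current z t m (current z s n f) +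
      (if s = !t ∧ n = -m then (n : ℂ) else 0) • f := by
  cases n using mode_cases with
  | zero => simp [current_zero]
  | neg a =>
    cases m using mode_cases with
    | zero => rw [if_neg (by omega), zero_smul, add_zero, current_zero, current_zero, map_smul]
    | neg b =>
      rw [if_neg (by omega), zero_smul, add_zero, current_neg, current_neg, current_neg,
        current_neg, mul_left_comm]
    | pos b =>
      rw [current_pos, current_pos, current_neg, current_neg, pderiv_X_mul, smul_add, mul_smul_comm,
        add_assoc, left_eq_add]
      by_cases h : t = !s ∧ b = a
      · obtain ⟨rfl, rfl⟩ := h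
        simp only [Bool.not_not, and_self, if_true]
        push_cast
        module
      · rw [if_neg h, if_neg (by cases s <;> cases t <;> grind), smul_zero, zero_smul, add_zero]
  | pos a =>
    cases m using mode_cases with
    | zero => simp [current_zero, show ((a : ℤ) + 1) ≠ 0 by omega]
    | neg b =>
      rw [current_pos, current_pos, current_neg, current_neg, pderiv_X_mul, smul_add, mul_smul_comm]
      congr 1
      by_cases h : s = !t ∧ a = b
      · obtain ⟨rfl, rfl⟩ := h
        simp
      · rw [if_neg h, if_neg (by grind), smul_zero, zero_smul]
    | pos b =>
      rw [if_neg (by omega), zero_smul, add_zero, current_pos, current_pos, current_pos,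
        current_pos, Derivation.map_smul, Derivation.map_smul, pderiv_pderiv_comm (!s, a),
        smul_comm]

theorem current_smooth (f : Fock) :
    ∃ N : ℤ, 0 ≤ N ∧ ∀ n : ℤ, N ≤ n → ∀ s, current z s n f = 0 := by
  refine ⟨(f.vars.sup Prod.snd : ℕ) + 2, by omega, fun n hn s => ?_⟩
  obtain ⟨m, rfl⟩ : ∃ m : ℕ, n = (m : ℤ) + 1 := ⟨(n - 1).toNat, by omega⟩
  rw [current_pos, pderiv_eq_zero_of_notMem_vars fun h => ?_, smul_zero]
  have hm : m ≤ f.vars.sup Prod.snd := Finset.le_sup (f := Prod.snd) h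
  omega

theorem current_one_of_pos (s : Bool) {n : ℤ} (hn : 0 < n) : current z s n 1 = 0 := by
  obtain ⟨m, rfl⟩ : ∃ m : ℕ, n = (m : ℤ) + 1 := ⟨(n - 1).toNat, by omega⟩
  rw [current_pos, pderiv_one, smul_zero]

theorem exists_eq_smul_of_commute_current {T : Module.End ℂ Fock}
    (hT : ∀ s n f, T (current z s n f) = current z s n (T f)) : ∃ a : ℂ, ∀ f, T f = a • f := by
  have hmul (f : Fock) : T f = f * T 1 := by
    induction f using MvPolynomial.induction_on with
    | C a => rw [← mul_one (C a), ← smul_eq_C_mul, map_smul, smul_mul_assoc, one_mul]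
    | add f g hf hg => rw [map_add, hf, hg, add_mul]
    | mul_X f i hf =>
      rw [mul_comm f, ← current_neg z i.1 i.2, hT, current_neg, current_neg, hf, mul_assoc]
  have hconst : T 1 = C (constantCoeff (T 1)) := by
    refine eq_C_of_forall_pderiv_eq_zero fun i => ?_
    have h := hT (!i.1) ((i.2 : ℤ) + 1) 1
    rw [current_one_of_pos z _ (by omega), map_zero, current_pos, Bool.not_not, eq_comm,
      smul_eq_zero] at h
    exact h.resolve_left (Nat.cast_add_one_ne_zero _)
  refine ⟨constantCoeff (T 1), fun f => ?_⟩
  rw [smul_eq_C_mul, ← hconst, mul_comm, hmul]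

end Current

section NormalProduct

variable (z : Bool → ℂ)

/-- The term `:J true k J false (n - k):` of the mode `n` of the normally ordered product of the
two currents. -/
noncomputable def normalProd (n k : ℤ) : Module.End ℂ Fock :=
  if k < 0 then current z true k * current z false (n - k)
  else current z false (n - k) * current z true k

variable {z} in
theorem normalProd_of_neg {n k : ℤ} (hk : k < 0) (f : Fock) :
    normalProd z n k f = current z true k (current z false (n - k) f) := by
  rw [normalProd, if_pos hk, Module.End.mul_apply]

variable {z} in
theorem normalProd_of_nonneg {n k : ℤ} (hk : 0 ≤ k) (f : Fock) :
    normalProd z n k f = current z false (n - k) (current z true k f) := by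
  rw [normalProd, if_neg hk.not_gt, Module.End.mul_apply]

theorem finite_support_normalProd (n : ℤ) (f : Fock) :
    (Function.support fun k => normalProd z n k f).Finite := by
  obtain ⟨N, hN_nonneg, hN⟩ := current_smooth z f
  refine (Set.finite_Ioo (min (n - N) (-1)) N).subset fun k hk => ?_
  rw [Function.mem_support] at hk
  rw [Set.mem_Ioo, min_lt_iff]
  rcases lt_or_ge k 0 with hk0 | hk0
  · refine ⟨.inl (lt_of_not_ge fun h => hk ?_), by omega⟩
    rw [normalProd_of_neg hk0, hN (n - k) (by omega), map_zero]
  · refine ⟨.inr (by omega), lt_of_not_ge fun h => hk ?_⟩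
    rw [normalProd_of_nonneg hk0, hN k h, map_zero]

theorem normalProd_current (n k m : ℤ) (s : Bool) (f : Fock) :
    normalProd z n k (current z s m f) = current z s m (normalProd z n k f) +
      if k = (if s then n + m else -m) then -(m : ℂ) • current z s (n + m) f else 0 := by
  have ht := current_comm z true s k m
  have hf := current_comm z false s (n - k) m
  have hcomm : normalProd z n k (current z s m f) = current z s m (normalProd z n k f) +
      ((if true = !s ∧ k = -m then (k : ℂ) else 0) • current z false (n - k) f +
        (if false = !s ∧ n - k = -m then ((n - k : ℤ) : ℂ) else 0) • current z true k f) := by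
    rcases lt_or_ge k 0 with hk | hk
    · rw [normalProd_of_neg hk, normalProd_of_neg hk, hf, map_add, map_smul, ht, add_assoc]
    · rw [normalProd_of_nonneg hk, normalProd_of_nonneg hk, ht, map_add, map_smul, hf, add_assoc,
        add_comm (_ • _)]
  have hkm : n - k = -m ↔ k = n + m := by omega
  rw [hcomm]
  congr 1
  cases s
  · by_cases h : k = -m <;> simp [h]
  · by_cases h : k = n + m <;> simp [h, hkm]

/-- The mode `n` of the normally ordered product of the two currents. -/
noncomputable def quad (n : ℤ) : Module.End ℂ Fock where
  toFun f := ∑ᶠ k : ℤ, normalProd z n k f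
  map_add' f g := by
    simp only [map_add]
    exact finsum_add_distrib (finite_support_normalProd z n f) (finite_support_normalProd z n g)
  map_smul' t f := by
    simp only [map_smul, RingHom.id_apply]
    exact (smul_finsum _ _).symm

theorem quad_apply (n : ℤ) (f : Fock) : quad z n f = ∑ᶠ k : ℤ, normalProd z n k f := rfl

theorem quad_current (n m : ℤ) (s : Bool) (f : Fock) :
    quad z n (current z s m f) =
      current z s m (quad z n f) + -(m : ℂ) • current z s (n + m) f := by
  have hcurrent : (Function.support fun k => current z s m (normalProd z n k f)).Finite :=
    (finite_support_normalProd z n f).subset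
      (Function.support_comp_subset (map_zero (current z s m)) _)
  have hsingle (a : ℤ) (y : Fock) : (Function.support fun k => if k = a then y else 0).Finite :=
    (Set.finite_singleton a).subset fun k hk => of_not_not fun h => hk (if_neg h)
  rw [quad_apply, quad_apply, finsum_congr fun k => normalProd_current z n k m s f,
    finsum_add_distrib hcurrent (hsingle _ _),
    IsLevelZeroRep.map_finsum' _ (finite_support_normalProd z n f)]
  congr 1
  rw [finsum_eq_single _ _ fun i hi => if_neg hi, if_pos rfl]

end NormalProduct

section Virasoro

variable (z ρ : Bool → ℂ)

/-- The Virasoro mode `n` on the Fock space, with background charges `ρ`. -/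
noncomputable def vir (n : ℤ) : Module.End ℂ Fock :=
  quad z n + ((n : ℂ) + 1) • (ρ true • current z true n + ρ false • current z false n)

theorem vir_apply (n : ℤ) (f : Fock) : vir z ρ n f = quad z n f +
    ((n : ℂ) + 1) • (ρ true • current z true n f + ρ false • current z false n f) := rfl

theorem vir_current (n m : ℤ) (s : Bool) (f : Fock) :
    vir z ρ n (current z s m f) = current z s m (vir z ρ n f) +
      -(m : ℂ) • current z s (n + m) f +
      (if n = -m then ρ (!s) * ((n : ℂ) ^ 2 + n) else 0) • f := by
  rw [vir_apply, vir_apply, quad_current, current_comm z true s n m, current_comm z false s n m]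
  simp only [map_add, map_smul]
  cases s <;>
  · simp only [Bool.not_false, Bool.not_true, true_and, Bool.false_eq_true, Bool.true_eq_false,
      false_and, if_false]
    split_ifs <;> module

end Virasoro

section VirasoroRelations

/-- The central charge of the Virasoro modes on the Fock space with background charges `ρ`. -/
noncomputable def centralCharge (ρ : Bool → ℂ) : ℂ := 2 - 24 * (ρ true * ρ false)

/-- The `L 0`-eigenvalue of the vacuum `1` of the Fock space. -/
noncomputable def lowestWeight (z ρ : Bool → ℂ) : ℂ :=
  z true * z false + ρ true * z true + ρ false * z false

variable (z ρ : Bool → ℂ)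

theorem vir_one_of_pos {n : ℤ} (hn : 0 < n) : vir z ρ n 1 = 0 := by
  have hquad : quad z n 1 = 0 := by
    refine finsum_eq_zero_of_forall_eq_zero fun k => ?_
    rcases lt_trichotomy k 0 with hk | rfl | hk
    · rw [normalProd_of_neg hk, current_one_of_pos z _ (by omega), map_zero]
    · rw [normalProd_of_nonneg le_rfl, current_zero, map_smul, sub_zero,
        current_one_of_pos z _ hn, smul_zero]
    · rw [normalProd_of_nonneg hk.le, current_one_of_pos z _ hk, map_zero]
  rw [vir_apply, hquad, current_one_of_pos z _ hn, current_one_of_pos z _ hn, smul_zero, smul_zero,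
    add_zero, smul_zero, add_zero]

theorem vir_zero_one : vir z ρ 0 1 = lowestWeight z ρ • 1 := by
  have hquad : quad z 0 1 = (z true * z false) • 1 := by
    rw [quad_apply, finsum_eq_single _ 0 fun k hk => ?_]
    · rw [normalProd_of_nonneg le_rfl, sub_zero, current_zero, current_zero, smul_smul,
        mul_comm]
    · rcases hk.lt_or_gt with hk | hk
      · rw [normalProd_of_neg hk, current_one_of_pos z _ (by omega), map_zero]
      · rw [normalProd_of_nonneg hk.le, current_one_of_pos z _ hk, map_zero]
  rw [vir_apply, hquad, current_zero, current_zero, lowestWeight, Int.cast_zero]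
  module

theorem quad_neg_one (n : ℕ) : quad z (-((n : ℤ) + 1)) 1 =
    z true • X (false, n) + z false • X (true, n) +
      ∑ k ∈ Finset.range n, X (true, k) * X (false, n - 1 - k) := by
  rw [quad_apply, finsum_int_eq_of_eq_zero n (fun k hk => ?_) fun k hk => ?_]
  · congr 1
    · congr 1
      · rw [normalProd_of_nonneg le_rfl, sub_zero, current_zero, map_smul, current_neg, mul_one]
      · rw [normalProd_of_neg (by omega), sub_self, current_zero, map_smul, current_neg, mul_one]
    · refine Finset.sum_congr rfl fun k hk => ?_
      have hkn : k < n := Finset.mem_range.1 hk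
      rw [normalProd_of_neg (by omega), show -((n : ℤ) + 1) - -((k : ℤ) + 1) =
        -(((n - 1 - k : ℕ) : ℤ) + 1) by omega, current_neg, current_neg, mul_one]
  · rw [normalProd_of_nonneg hk.le, current_one_of_pos z _ hk, map_zero]
  · rw [normalProd_of_neg (by omega), current_one_of_pos z _ (by omega), map_zero]

theorem vir_neg_one (n : ℕ) : vir z ρ (-((n : ℤ) + 1)) 1 =
    (z true - ρ false * n) • X (false, n) + (z false - ρ true * n) • X (true, n) +
      ∑ k ∈ Finset.range n, X (true, k) * X (false, n - 1 - k) := by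
  rw [vir_apply, quad_neg_one, current_neg, current_neg, mul_one, mul_one]
  push_cast
  module

theorem vir_pos_X {n j : ℕ} (hj : j ≤ n) (s : Bool) : vir z ρ ((n : ℤ) + 1) (X (s, j)) =
    (if j = n then ((n : ℂ) + 1) * z s + ρ (!s) * (((n : ℂ) + 1) ^ 2 + (n + 1)) else 0) • 1 := by
  rw [← mul_one (X _), ← current_neg z, vir_current, vir_one_of_pos z ρ (by omega), map_zero,
    zero_add]
  rcases hj.eq_or_lt with rfl | hj
  · rw [if_pos (neg_neg _).symm, if_pos rfl, add_neg_cancel, current_zero]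
    push_cast
    module
  · rw [if_neg (by omega), if_neg hj.ne, current_one_of_pos z _ (by omega), smul_zero, zero_smul,
      add_zero]

theorem vir_pos_X_mul_X {n k : ℕ} (hk : k < n) :
    vir z ρ ((n : ℤ) + 1) (X (true, k) * X (false, n - 1 - k)) =
      (((k : ℂ) + 1) * (n - k)) • 1 := by
  obtain ⟨j, rfl⟩ := Nat.exists_eq_add_of_lt hk
  rw [← current_neg z, vir_current, vir_pos_X z ρ (by omega), if_neg (by omega), if_neg (by omega),
    zero_smul, map_zero, zero_add, zero_smul, add_zero,
    show k + j + 1 - 1 - k = j by omega,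
    show ((k + j + 1 : ℕ) : ℤ) + 1 + -((k : ℤ) + 1) = (j : ℤ) + 1 by push_cast; ring,
    current_pos, Bool.not_true, pderiv_X_self, smul_smul]
  push_cast
  congr 1
  ring

theorem sum_range_add_one_mul_sub (n : ℕ) :
    ∑ k ∈ Finset.range n, ((k : ℂ) + 1) * (n - k) = (((n : ℂ) + 1) ^ 3 - (n + 1)) / 6 := by
  have hsum (m : ℕ) (a : ℂ) : ∑ k ∈ Finset.range m, ((k : ℂ) + 1) * (a - k) =
      a * (m * (m + 1)) / 2 - (m - 1) * m * (m + 1) / 3 := by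
    induction m with
    | zero => simp
    | succ m ih =>
      rw [Finset.sum_range_succ, ih]
      push_cast
      ring
  rw [hsum]
  ring

theorem vir_pos_vir_neg_one (n : ℕ) :
    vir z ρ ((n : ℤ) + 1) (vir z ρ (-((n : ℤ) + 1)) 1) = (2 * (n + 1) * lowestWeight z ρ +
      (((n : ℂ) + 1) ^ 3 - (n + 1)) / 12 * centralCharge ρ) • 1 := by
  rw [vir_neg_one, map_add, map_add, map_smul, map_smul, map_sum,
    Finset.sum_congr rfl fun k hk => vir_pos_X_mul_X z ρ (Finset.mem_range.1 hk),
    ← Finset.sum_smul, sum_range_add_one_mul_sub, vir_pos_X z ρ le_rfl, vir_pos_X z ρ le_rfl,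
    if_pos rfl, if_pos rfl, lowestWeight, centralCharge]
  simp only [Bool.not_false, Bool.not_true]
  module

/-- The derivation of the Fock space that shifts the modes of the currents, with the coefficients
by which `vir (-n)` does. -/
noncomputable def shiftDerivation (n : ℕ) : Derivation ℂ Fock Fock :=
  mkDerivation ℂ fun i => ((i.2 : ℂ) + 1) • X (i.1, i.2 + n)

theorem shiftDerivation_X (n : ℕ) (i : Bool × ℕ) :
    shiftDerivation n (X i) = ((i.2 : ℂ) + 1) • X (i.1, i.2 + n) :=
  mkDerivation_X ..

theorem vir_neg_eq (n : ℕ) (f : Fock) :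
    vir z ρ (-(n : ℤ)) f = f * vir z ρ (-(n : ℤ)) 1 + shiftDerivation n f := by
  induction f using MvPolynomial.induction_on with
  | C a =>
    rw [← algebraMap_eq, Derivation.map_algebraMap, add_zero, ← Algebra.smul_def, ← map_smul,
      Algebra.algebraMap_eq_smul_one]
  | add f g hf hg => rw [map_add, map_add, hf, hg, add_mul, add_add_add_comm]
  | mul_X f i hf =>
    have hshift : -(n : ℤ) + -((i.2 : ℤ) + 1) = -(((i.2 + n : ℕ) : ℤ) + 1) := by
      push_cast
      ring
    rw [mul_comm f, ← current_neg z i.1 i.2, vir_current, if_neg (by omega), zero_smul, add_zero,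
      hshift, current_neg, current_neg, current_neg, hf, Derivation.leibniz, shiftDerivation_X]
    push_cast
    simp only [smul_eq_mul, Algebra.smul_def, map_neg, map_add]
    ring

theorem vir_zero_eq (f : Fock) :
    vir z ρ 0 f = lowestWeight z ρ • f + shiftDerivation 0 f := by
  have h := vir_neg_eq z ρ 0 f
  rwa [Nat.cast_zero, neg_zero, vir_zero_one, mul_smul_comm, mul_one] at h

theorem shiftDerivation_zero_vir_neg_one (n : ℕ) :
    shiftDerivation 0 (vir z ρ (-((n : ℤ) + 1)) 1) =
      ((n : ℂ) + 1) • vir z ρ (-((n : ℤ) + 1)) 1 := by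
  have hprod : ∀ k ∈ Finset.range n, shiftDerivation 0 (X (true, k) * X (false, n - 1 - k)) =
      ((n : ℂ) + 1) • (X (true, k) * X (false, n - 1 - k)) := by
    intro k hk
    obtain ⟨j, rfl⟩ := Nat.exists_eq_add_of_lt (Finset.mem_range.1 hk)
    rw [show k + j + 1 - 1 - k = j by omega, Derivation.leibniz, shiftDerivation_X,
      shiftDerivation_X, smul_eq_mul, smul_eq_mul, mul_smul_comm, mul_smul_comm,
      mul_comm (X (false, _))]
    simp only [add_zero]
    push_cast
    module
  rw [vir_neg_one, map_add, map_add, map_sum, Finset.sum_congr rfl hprod, ← Finset.smul_sum,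
    Derivation.map_smul, Derivation.map_smul, shiftDerivation_X, shiftDerivation_X]
  module

theorem vir_zero_vir_one (m : ℤ) :
    vir z ρ 0 (vir z ρ m 1) = (lowestWeight z ρ - m) • vir z ρ m 1 := by
  cases m using mode_cases with
  | neg k =>
    rw [vir_zero_eq, shiftDerivation_zero_vir_neg_one]
    push_cast
    module
  | zero => rw [vir_zero_one, map_smul, vir_zero_one, Int.cast_zero, sub_zero]
  | pos k => rw [vir_one_of_pos z ρ (by omega), map_zero, smul_zero]

/-- The failure of the operators `vir n` to satisfy the Witt relations. -/
noncomputable def wittDefect (n m : ℤ) : Module.End ℂ Fock :=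
  vir z ρ n * vir z ρ m - vir z ρ m * vir z ρ n - ((n : ℂ) - m) • vir z ρ (n + m)

theorem wittDefect_apply (n m : ℤ) (f : Fock) : wittDefect z ρ n m f =
    vir z ρ n (vir z ρ m f) - vir z ρ m (vir z ρ n f) - ((n : ℂ) - m) • vir z ρ (n + m) f := rfl

theorem wittDefect_current (n m : ℤ) (s : Bool) (k : ℤ) (f : Fock) :
    wittDefect z ρ n m (current z s k f) = current z s k (wittDefect z ρ n m f) := by
  simp only [wittDefect_apply, vir_current, map_add, map_sub, map_smul]
  have hn : n + (m + k) = n + m + k := by ring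
  have hm : m + (n + k) = n + m + k := by ring
  have hn_eq : n = -(m + k) ↔ n + m = -k := by omega
  have hm_eq : m = -(n + k) ↔ n + m = -k := by omega
  simp only [hn, hm, hn_eq, hm_eq]
  by_cases h : n + m = -k
  · obtain rfl : k = -(n + m) := by omega
    simp only [if_pos h]
    push_cast
    module
  · simp only [if_neg h]
    push_cast
    module

variable {z ρ} in
theorem wittDefect_eq_smul {n m : ℤ} {a : ℂ} (h : wittDefect z ρ n m 1 = a • 1) (f : Fock) :
    wittDefect z ρ n m f = a • f := by
  obtain ⟨b, hb⟩ := exists_eq_smul_of_commute_current z (wittDefect_current z ρ n m)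
  rw [hb, smul_left_injective ℂ (one_ne_zero (α := Fock)) ((hb 1).symm.trans h)]

theorem vir_zero_vir (m : ℤ) (f : Fock) :
    vir z ρ 0 (vir z ρ m f) = vir z ρ m (vir z ρ 0 f) - (m : ℂ) • vir z ρ m f := by
  have hone : wittDefect z ρ 0 m 1 = (0 : ℂ) • 1 := by
    rw [wittDefect_apply, vir_zero_vir_one, vir_zero_one, map_smul, zero_add, Int.cast_zero]
    module
  have h := wittDefect_eq_smul hone f
  rw [wittDefect_apply, zero_add, Int.cast_zero, zero_smul, sub_eq_zero, sub_eq_iff_eq_add] at h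
  rw [h]
  module

theorem wittDefect_eq_zero {n m : ℤ} (h : n + m ≠ 0) (f : Fock) : wittDefect z ρ n m f = 0 := by
  obtain ⟨a, ha⟩ := exists_eq_smul_of_commute_current z (wittDefect_current z ρ n m)
  -- The defect shifts the `L 0`-weight by `-(n + m)`, so a scalar defect vanishes.
  have hweight : vir z ρ 0 (wittDefect z ρ n m f) =
      wittDefect z ρ n m (vir z ρ 0 f) - ((n : ℂ) + m) • wittDefect z ρ n m f := by
    simp only [wittDefect_apply, map_sub, map_smul, vir_zero_vir]
    push_cast
    module
  rw [ha (vir z ρ 0 f), ha f, map_smul, eq_comm, sub_eq_self, smul_eq_zero, ← ha f] at hweight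
  exact hweight.resolve_left (by exact_mod_cast h)

theorem wittDefect_neg_pos (n : ℕ) (f : Fock) :
    wittDefect z ρ ((n : ℤ) + 1) (-((n : ℤ) + 1)) f =
      ((((n : ℂ) + 1) ^ 3 - (n + 1)) / 12 * centralCharge ρ) • f := by
  refine wittDefect_eq_smul ?_ f
  rw [wittDefect_apply, vir_pos_vir_neg_one, vir_one_of_pos z ρ (by omega), map_zero,
    add_neg_cancel, vir_zero_one]
  push_cast
  module

theorem wittDefect_skew (n m : ℤ) (f : Fock) : wittDefect z ρ n m f = -wittDefect z ρ m n f := by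
  rw [wittDefect_apply, wittDefect_apply, add_comm m n]
  module

theorem wittDefect_neg (n : ℤ) (f : Fock) :
    wittDefect z ρ n (-n) f = (((n : ℂ) ^ 3 - n) / 12 * centralCharge ρ) • f := by
  cases n using mode_cases with
  | neg k =>
    rw [wittDefect_skew, neg_neg, wittDefect_neg_pos]
    push_cast
    module
  | zero =>
    rw [wittDefect_apply, neg_zero, Int.cast_zero]
    module
  | pos k => exact_mod_cast wittDefect_neg_pos z ρ k f

theorem vir_vir (n m : ℤ) (f : Fock) :
    vir z ρ n (vir z ρ m f) = vir z ρ m (vir z ρ n f) + ((n : ℂ) - m) • vir z ρ (n + m) f +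
      (if n = -m then ((n : ℂ) ^ 3 - n) / 12 * centralCharge ρ else 0) • f := by
  have h : wittDefect z ρ n m f =
      (if n = -m then ((n : ℂ) ^ 3 - n) / 12 * centralCharge ρ else 0) • f := by
    split_ifs with hnm
    · obtain rfl : m = -n := by omega
      exact wittDefect_neg z ρ n f
    · rw [wittDefect_eq_zero z ρ (by omega), zero_smul]
  rw [← h, wittDefect_apply]
  abel

theorem isLevelZeroRep :
    IsLevelZeroRep (vir z ρ) (current z true) (centralCharge ρ) (-ρ false) where
  LL := vir_vir z ρ
  LI n m f := by
    rw [vir_current, Bool.not_true, sub_eq_add_neg, ← neg_smul]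
    congr 2
    split_ifs
    · ring
    · rw [neg_zero]
  II n m f := by rw [current_comm, if_neg (by simp), zero_smul, add_zero]
  smooth f := by
    obtain ⟨N, -, hN⟩ := current_smooth z f
    exact ⟨N, fun n hn => hN n hn true⟩

theorem isHighestWeightVector_one :
    IsHighestWeightVector (vir z ρ) (current z true) (lowestWeight z ρ) (z true) 1 where
  L_pos _ hn := vir_one_of_pos z ρ hn
  L_zero := vir_zero_one z ρ
  mem_vacua := ⟨fun _ hk => current_one_of_pos z _ hk, current_zero z _ _⟩

end VirasoroRelations

end Fock

section Derivation

open MvPolynomial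

variable {σ R : Type*} [CommSemiring R]

theorem derivation_monomial (D : Derivation R (MvPolynomial σ R) (MvPolynomial σ R))
    (d : σ →₀ ℕ) (a : R) : D (monomial d a) =
      a • d.sum fun i k => monomial (d - Finsupp.single i 1) (k : R) * D (X i) := by
  rw [show D = mkDerivation R fun i => D (X i) from derivation_ext fun i => by rw [mkDerivation_X],
    mkDerivation_monomial]
  simp only [mkDerivation_X, smul_eq_mul]

theorem isWeightedHomogeneous_derivation {M : Type*} [AddCommMonoid M] {w : σ → M}
    {D : Derivation R (MvPolynomial σ R) (MvPolynomial σ R)}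
    (hD : ∀ i, IsWeightedHomogeneous w (D (X i)) (w i)) {f : MvPolynomial σ R} {n : M}
    (hf : IsWeightedHomogeneous w f n) : IsWeightedHomogeneous w (D f) n := by
  induction hf using IsWeightedHomogeneous.induction_on with
  | zero => rw [map_zero]; exact isWeightedHomogeneous_zero R w n
  | add f g _ _ hf hg => rw [map_add]; exact hf.add hg
  | monomial d a hd =>
    rw [derivation_monomial, smul_eq_C_mul]
    refine (IsWeightedHomogeneous.sum _ _ n fun i hi => ?_).C_mul a
    have hi_ne : d i ≠ 0 := Finsupp.mem_support_iff.1 hi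
    have hweight : Finsupp.weight w (d - Finsupp.single i 1) + w i = n := by
      rw [← hd, Finsupp.weight_sub_single_add hi_ne]
    exact hweight ▸ (isWeightedHomogeneous_monomial w _ _ rfl).mul (hD i)

theorem derivation_monomial_of_X_eq_smul {w : σ → ℕ}
    {D : Derivation R (MvPolynomial σ R) (MvPolynomial σ R)} (hD : ∀ i, D (X i) = (w i : R) • X i)
    (d : σ →₀ ℕ) (a : R) : D (monomial d a) = (Finsupp.weight w d : R) • monomial d a := by
  have hterm : ∀ i ∈ d.support, monomial (d - Finsupp.single i 1) (d i : R) * D (X i) =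
      ((d i * w i : ℕ) : R) • monomial d 1 := by
    intro i hi
    have hi_ne : d i ≠ 0 := Finsupp.mem_support_iff.1 hi
    rw [hD, X, mul_smul_comm, monomial_mul, mul_one,
      tsub_add_cancel_of_le (Finsupp.single_le_iff.2 (Nat.one_le_iff_ne_zero.2 hi_ne)),
      smul_monomial, smul_monomial]
    rw [smul_eq_mul, smul_eq_mul, mul_one, Nat.cast_mul, mul_comm]
  rw [derivation_monomial, Finsupp.sum, Finset.sum_congr rfl hterm, ← Finset.sum_smul,
    ← Nat.cast_sum, smul_comm, smul_monomial, smul_eq_mul, mul_one, Finsupp.weight_apply,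
    Finsupp.sum]
  simp only [smul_eq_mul]

end Derivation

namespace Fock

open MvPolynomial

section Surjectivity

variable (z ρ : Bool → ℂ)

theorem vir_zero_basisMonomials (d : Bool × ℕ →₀ ℕ) :
    vir z ρ 0 (basisMonomials (Bool × ℕ) ℂ d) =
      (lowestWeight z ρ + (Finsupp.weight (fun i : Bool × ℕ => i.2 + 1) d : ℕ)) •
        basisMonomials (Bool × ℕ) ℂ d := by
  have hX (i : Bool × ℕ) : shiftDerivation 0 (X i) = ((i.2 + 1 : ℕ) : ℂ) • X i := by
    rw [shiftDerivation_X, add_zero, Nat.cast_add_one]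
  rw [coe_basisMonomials, vir_zero_eq, derivation_monomial_of_X_eq_smul hX, add_smul]

/-- The degree in the modes of the current `J false`, as a weight on the variables. -/
def falseDegree (i : Bool × ℕ) : ℕ := if i.1 then 0 else 1

variable {z ρ} {R : Submodule ℂ Fock}

theorem weightedHomogeneousSubmodule_falseDegree_zero_le (h1 : 1 ∈ R)
    (hX : ∀ m : ℕ, ∀ f ∈ R, X (true, m) * f ∈ R) :
    weightedHomogeneousSubmodule ℂ falseDegree 0 ≤ R := by
  have hmonomial (d : Bool × ℕ →₀ ℕ) : Finsupp.weight falseDegree d = 0 →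
      ∀ f ∈ R, monomial d 1 * f ∈ R := by
    induction d using Finsupp.induction_linear with
    | zero => exact fun _ f hf => (one_mul f).symm ▸ hf
    | add d e hd he =>
      intro hde f hf
      rw [map_add, Nat.add_eq_zero_iff] at hde
      rw [← one_mul 1, ← monomial_mul, mul_assoc]
      exact hd hde.1 _ (he hde.2 f hf)
    | single i k =>
      intro hik f hf
      induction k with
      | zero => rwa [Finsupp.single_zero, monomial_zero', C_1, one_mul]
      | succ k ih =>
        rw [Finsupp.weight_single, smul_eq_mul, Nat.mul_eq_zero] at hik
        rcases i with ⟨_ | _, m⟩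
        · simp [falseDegree] at hik
        · rw [add_comm, Finsupp.single_add, ← one_mul (1 : ℂ), ← monomial_mul, mul_assoc]
          exact hX m _ (ih (by rw [Finsupp.weight_single]; exact mul_zero k))
  intro f hf
  induction hf using IsWeightedHomogeneous.induction_on with
  | zero => exact R.zero_mem
  | add f g _ _ hf hg => exact R.add_mem hf hg
  | monomial d a hd =>
    rw [show monomial d a = a • (monomial d 1 * 1) by
      rw [mul_one, smul_monomial, smul_eq_mul, mul_one]]
    exact R.smul_mem a (hmonomial d hd 1 h1)

theorem X_false_mul_mem (hz : ∀ n : ℕ, z true - ρ false * n ≠ 0)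
    (hR : ∀ n : ℕ, ∀ f ∈ R, vir z ρ (-((n : ℤ) + 1)) f ∈ R) {D : ℕ}
    (hD : weightedHomogeneousSubmodule ℂ falseDegree D ≤ R) (n : ℕ) :
    ∀ f ∈ weightedHomogeneousSubmodule ℂ falseDegree D, X (false, n) * f ∈ R := by
  induction n using Nat.strong_induction_on with | _ n ih =>
  intro f hf
  have hX (j : ℕ) : X (true, j) * f ∈ weightedHomogeneousSubmodule ℂ falseDegree D := by
    have h := (isWeightedHomogeneous_X ℂ falseDegree (true, j)).mul hf
    rwa [show falseDegree (true, j) = 0 from rfl, zero_add] at h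
  have hshift : shiftDerivation (n + 1) f ∈ R :=
    hD (isWeightedHomogeneous_derivation (fun i => by
      rw [shiftDerivation_X, smul_eq_C_mul]
      exact (isWeightedHomogeneous_X ℂ falseDegree _).C_mul _) hf)
  have hsum : ∑ k ∈ Finset.range n, f * (X (true, k) * X (false, n - 1 - k)) ∈ R := by
    refine R.sum_mem fun k hk => ?_
    have hk_lt : k < n := Finset.mem_range.1 hk
    rw [mul_left_comm, mul_comm f, mul_left_comm]
    exact ih _ (by omega) _ (hX k)
  have htrue : (z false - ρ true * n) • (X (true, n) * f) ∈ R := R.smul_mem _ (hD (hX n))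
  have hvir : vir z ρ (-((n : ℤ) + 1)) f = (z true - ρ false * n) • (X (false, n) * f) +
      (z false - ρ true * n) • (X (true, n) * f) +
      ∑ k ∈ Finset.range n, f * (X (true, k) * X (false, n - 1 - k)) +
      shiftDerivation (n + 1) f := by
    have h := vir_neg_eq z ρ (n + 1) f
    rwa [Nat.cast_add_one, vir_neg_one, mul_add, mul_add, mul_smul_comm, mul_smul_comm,
      Finset.mul_sum, mul_comm f, mul_comm f] at h
  have hmem := hR n f (hD hf)
  rw [hvir, R.add_mem_iff_left hshift, R.add_mem_iff_left hsum, R.add_mem_iff_left htrue] at hmem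
  exact (R.smul_mem_iff (hz n)).1 hmem

theorem weightedHomogeneousSubmodule_falseDegree_le
    (h0 : weightedHomogeneousSubmodule ℂ falseDegree 0 ≤ R)
    (hX : ∀ D, weightedHomogeneousSubmodule ℂ falseDegree D ≤ R → ∀ n : ℕ,
      ∀ f ∈ weightedHomogeneousSubmodule ℂ falseDegree D, X (false, n) * f ∈ R) (D : ℕ) :
    weightedHomogeneousSubmodule ℂ falseDegree D ≤ R := by
  induction D with
  | zero => exact h0
  | succ D ih =>
    intro f hf
    induction hf using IsWeightedHomogeneous.induction_on with
    | zero => exact R.zero_mem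
    | add f g _ _ hf hg => exact R.add_mem hf hg
    | monomial d a hd =>
      obtain ⟨n, hn⟩ : ∃ n, d (false, n) ≠ 0 := by
        by_contra! h
        refine D.succ_ne_zero (hd.symm.trans (Finset.sum_eq_zero fun i _ => ?_))
        rcases i with ⟨_ | _, n⟩ <;> simp [falseDegree, h]
      have hweight : Finsupp.weight falseDegree (d - Finsupp.single (false, n) 1) = D := by
        have h := Finsupp.weight_sub_single_add (w := falseDegree) hn
        rw [hd] at h
        exact Nat.add_right_cancel h
      rw [← one_mul a, ← add_tsub_cancel_of_le
        (Finsupp.single_le_iff.2 (Nat.one_le_iff_ne_zero.2 hn)), ← monomial_mul]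
      exact hX D ih n _ (isWeightedHomogeneous_monomial _ _ _ hweight)

theorem eq_top_of_vir_mem (hz : ∀ n : ℕ, z true - ρ false * n ≠ 0)
    (h0 : weightedHomogeneousSubmodule ℂ falseDegree 0 ≤ R)
    (hR : ∀ n : ℕ, ∀ f ∈ R, vir z ρ (-((n : ℤ) + 1)) f ∈ R) : R = ⊤ := by
  have hle := weightedHomogeneousSubmodule_falseDegree_le h0 fun D hD => X_false_mul_mem hz hR hD
  refine eq_top_iff.2 fun f _ => ?_
  rw [f.as_sum]
  exact R.sum_mem fun d _ => hle _ (isWeightedHomogeneous_monomial falseDegree d _ rfl)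

end Surjectivity

end Fock

section Psi

variable {cL cW cLI h hW hI : ℂ} (hcW : cW = -24 * cLI ^ 2) (hhW : hW = hI * (hI - 2 * cLI))

theorem I_mem_range_Psi_inf_heisenbergVacua (hI_ne : ∀ m : ℕ, hI + cLI * m ≠ 0) (m : ℕ) :
    ∀ x ∈ LinearMap.range (Psi (cL := cL) (h := h) hcW hhW) ⊓
        heisenbergVacua (HVir.opI cL 0 cLI h hI) hI,
      HVir.opI cL 0 cLI h hI (-((m : ℤ) + 1)) x ∈
        LinearMap.range (Psi (cL := cL) (h := h) hcW hhW) ⊓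
          heisenbergVacua (HVir.opI cL 0 cLI h hI) hI := by
  induction m using Nat.strong_induction_on with | _ m ih =>
  rintro x ⟨⟨y, rfl⟩, hx⟩
  have H := HVir.isLevelZeroRep cL cLI h hI
  refine ⟨?_, H.I_mem_heisenbergVacua hx _⟩
  have hW_eq := H.wMode_neg_eq hx m
  rw [← HVir.opW, ← w22Action_W, ← Psi_smul, ← sub_eq_iff_eq_add] at hW_eq
  refine (Submodule.smul_mem_iff _ (mul_ne_zero two_ne_zero (hI_ne m))).1 ?_
  rw [← hW_eq]
  refine sub_mem ⟨_, rfl⟩ (sum_mem fun k hk => ?_)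
  rw [Finset.mem_range] at hk
  have hinner := ih (m - k - 1) (by omega) _ ⟨⟨y, rfl⟩, hx⟩
  rw [show -(((m - k - 1 : ℕ) : ℤ) + 1) = k - m by omega] at hinner
  exact (ih k hk _ hinner).1

theorem hwv_mem_range_Psi_inf_heisenbergVacua :
    HVir.hwv cL 0 cLI h hI ∈ LinearMap.range (Psi (cL := cL) (h := h) hcW hhW) ⊓
      heisenbergVacua (HVir.opI cL 0 cLI h hI) hI :=
  ⟨⟨_, Psi_hwv hcW hhW⟩, (HVir.isHighestWeightVector_hwv cL 0 cLI h hI).mem_vacua⟩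

theorem schurVector_mem_range_Psi (hcLI : cLI ≠ 0) (hI_ne : ∀ m : ℕ, hI + cLI * m ≠ 0) (r : ℕ) :
    schurVector cL 0 cLI h hI r ∈ LinearMap.range (Psi (cL := cL) (h := h) hcW hhW) := by
  have hS := HVir.isSchurSequence_schurVector (cL := cL) (h := h) (hI := hI) hcLI
  have hmem := hS.mem_of_mem_zero hcLI (by simpa only [lt_irrefl, if_false, Int.toNat_zero,
      HVir.schurVector_zero] using hwv_mem_range_Psi_inf_heisenbergVacua hcW hhW)
    (I_mem_range_Psi_inf_heisenbergVacua hcW hhW hI_ne) r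
  exact hmem.1

end Psi

namespace Fock

open MvPolynomial

theorem exists_parameters {cL cLI h hI : ℂ} (hcLI : cLI ≠ 0) (hI_ne : hI ≠ cLI) :
    ∃ z ρ : Bool → ℂ, centralCharge ρ = cL ∧ -ρ false = cLI ∧ lowestWeight z ρ = h ∧
      z true = hI := by
  have hsub : hI - cLI ≠ 0 := sub_ne_zero.2 hI_ne
  refine ⟨fun s => if s then hI else (h - (cL - 2) / (24 * cLI) * hI) / (hI - cLI),
    fun s => if s then (cL - 2) / (24 * cLI) else -cLI, ?_, neg_neg cLI, ?_, rfl⟩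
  · simp only [centralCharge, if_true, Bool.false_eq_true, if_false]
    field_simp
    ring
  · simp only [lowestWeight, if_true, Bool.false_eq_true, if_false]
    field_simp
    ring

variable (z ρ : Bool → ℂ)

/-- The free field realization: the homomorphism from the Verma module of the twisted
Heisenberg-Virasoro algebra to the Fock space that sends the highest weight vector to `1`. -/
noncomputable def ofVerma :
    HVir.Verma (centralCharge ρ) 0 (-ρ false) (lowestWeight z ρ) (z true) →ₗ[ℂ] Fock :=
  (isLevelZeroRep z ρ).ofVerma (isHighestWeightVector_one z ρ)

theorem ofVerma_hwv : ofVerma z ρ (HVir.hwv _ 0 _ _ _) = 1 :=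
  (isLevelZeroRep z ρ).ofVerma_hwv _

theorem ofVerma_I_neg (m : ℕ) (x : HVir.Verma (centralCharge ρ) 0 (-ρ false) _ _) :
    ofVerma z ρ (HVir.opI _ 0 _ _ _ (-((m : ℤ) + 1)) x) = X (true, m) * ofVerma z ρ x := by
  rw [ofVerma, (isLevelZeroRep z ρ).ofVerma_I, current_neg]

theorem ofVerma_Psi_L_smul {cW hW : ℂ} (hcW : cW = -24 * (-ρ false) ^ 2)
    (hhW : hW = z true * (z true - 2 * -ρ false)) (n : ℤ)
    (y : W22.Verma (centralCharge ρ) cW _ hW) :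
    ofVerma z ρ (Psi hcW hhW (W22.L n • y)) = vir z ρ n (ofVerma z ρ (Psi hcW hhW y)) := by
  rw [Psi_smul, w22Action_L, ofVerma, (isLevelZeroRep z ρ).ofVerma_L]

theorem surjective_ofVerma_comp_Psi {cW hW : ℂ} (hcW : cW = -24 * (-ρ false) ^ 2)
    (hhW : hW = z true * (z true - 2 * -ρ false))
    (hz : ∀ m : ℕ, z true + -ρ false * m ≠ 0) :
    Function.Surjective (ofVerma z ρ ∘ₗ Psi hcW hhW) := by
  rw [← LinearMap.range_eq_top]
  refine eq_top_of_vir_mem (z := z) (ρ := ρ)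
    (fun n => by rw [sub_eq_add_neg, ← neg_mul]; exact hz n) ?_ ?_
  · refine (weightedHomogeneousSubmodule_falseDegree_zero_le
      (R := (LinearMap.range (Psi hcW hhW) ⊓ heisenbergVacua _ (z true)).map (ofVerma z ρ))
      ⟨_, hwv_mem_range_Psi_inf_heisenbergVacua hcW hhW, ofVerma_hwv z ρ⟩ ?_).trans ?_
    · rintro m _ ⟨x, hx, rfl⟩
      exact ⟨_, I_mem_range_Psi_inf_heisenbergVacua hcW hhW hz m x hx, ofVerma_I_neg z ρ m x⟩
    · rintro _ ⟨_, ⟨⟨y, rfl⟩, -⟩, rfl⟩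
      exact ⟨y, rfl⟩
  · rintro n _ ⟨y, rfl⟩
    exact ⟨_, ofVerma_Psi_L_smul z ρ hcW hhW _ y⟩

theorem aeval_ofVerma_schurVector (hρ : ρ false ≠ 0) (r : ℕ) :
    aeval (fun _ => ρ false) (ofVerma z ρ (schurVector (centralCharge ρ) 0 (-ρ false) _ _ r)) =
      (1 : ℂ) := by
  induction r using Nat.strong_induction_on with | _ r ih =>
  rcases r.eq_zero_or_pos with rfl | hr
  · rw [HVir.schurVector_zero, ofVerma_hwv, map_one]
  have hr_ne : (r : ℂ) ≠ 0 := Nat.cast_ne_zero.2 hr.ne'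
  refine mul_left_cancel₀ hr_ne ?_
  rw [← smul_eq_mul, ← map_smul, ← map_smul, HVir.natCast_smul_schurVector]
  simp only [map_smul, map_sum, ofVerma_I_neg, map_mul, aeval_X]
  rw [Finset.sum_congr rfl fun k hk => by
    rw [ih (r - 1 - k) (by have := Finset.mem_range.1 hk; omega), mul_one]]
  rw [Finset.sum_const, Finset.card_range, nsmul_eq_mul, smul_eq_mul]
  field_simp

end Fock

theorem Psi_injective {cL cW cLI h hW hI : ℂ} (hcW : cW = -24 * cLI ^ 2)
    (hhW : hW = hI * (hI - 2 * cLI)) (hcLI : cLI ≠ 0) (hI_ne_cLI : hI ≠ cLI)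
    (hI_ne : ∀ m : ℕ, hI + cLI * m ≠ 0) :
    Function.Injective (Psi (cL := cL) (h := h) hcW hhW) := by
  obtain ⟨z, ρ, rfl, rfl, rfl, rfl⟩ := Fock.exists_parameters (cL := cL) (h := h) hcLI hI_ne_cLI
  have hfinite (n : ℕ) : {i : Bool × ℕ | i.2 + 1 ≤ n}.Finite :=
    (Set.finite_univ.prod (Set.finite_lt_nat n)).subset fun i hi => ⟨trivial, hi⟩
  refine .of_comp (f := Fock.ofVerma z ρ) (injective_of_surjective_of_eigenvectors
    (Fock.surjective_ofVerma_comp_Psi z ρ hcW hhW hI_ne)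
    (T := Algebra.lsmul ℂ ℂ _ (W22.L 0)) (S := Fock.vir z ρ 0)
    (Fock.ofVerma_Psi_L_smul z ρ hcW hhW 0) (fun μ => ?_) W22.L_zero_smul_pbwMonomial
    W22.span_pbwMonomial_eq_top (MvPolynomial.basisMonomials (Bool × ℕ) ℂ)
    (Fock.vir_zero_basisMonomials z ρ))
  rcases Set.eq_empty_or_nonempty
    ((fun d : Bool × ℕ →₀ ℕ => Fock.lowestWeight z ρ +
      (Finsupp.weight (fun i : Bool × ℕ => i.2 + 1) d : ℕ)) ⁻¹' {μ}) with hμ | ⟨d, rfl⟩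
  · rw [hμ]
    exact Set.finite_empty
  · exact (finite_setOf_weight_eq (fun i => i.2.succ_ne_zero) hfinite _).subset fun e he =>
      Nat.cast_injective (add_left_cancel he)

theorem HVir.schurVector_ne_zero {cL cLI h hI : ℂ} (hcLI : cLI ≠ 0) (hI_ne : hI ≠ cLI) (r : ℕ) :
    schurVector cL 0 cLI h hI r ≠ 0 := by
  obtain ⟨z, ρ, rfl, rfl, rfl, rfl⟩ := Fock.exists_parameters (cL := cL) (h := h) hcLI hI_ne
  intro h0
  have hone := Fock.aeval_ofVerma_schurVector z ρ (neg_ne_zero.1 hcLI) r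
  rw [h0, map_zero, map_zero] at hone
  exact zero_ne_one hone

theorem HVir.isHighestWeightVector_schurVector {cL cLI h hI : ℂ} (hcLI : cLI ≠ 0) {p : ℕ}
    (hp : hI = (p + 1) * cLI) :
    IsHighestWeightVector (opL cL 0 cLI h hI) (opI cL 0 cLI h hI) (h + p) hI
      (schurVector cL 0 cLI h hI p) := by
  have H := isLevelZeroRep cL cLI h hI
  have hS := isSchurSequence_schurVector (cL := cL) (h := h) (hI := hI) hcLI
  have h0 : IsHighestWeightVector (opL cL 0 cLI h hI) (opI cL 0 cLI h hI) h hI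
      (schurVector cL 0 cLI h hI 0) := schurVector_zero ▸ isHighestWeightVector_hwv cL 0 cLI h hI
  refine ⟨fun n hn => ?_, hS.L_zero_apply H hcLI h0.L_zero p,
    hS.mem_heisenbergVacua H hcLI h0.mem_vacua p⟩
  obtain ⟨a, rfl⟩ : ∃ a : ℕ, n = a + 1 := ⟨(n - 1).toNat, by omega⟩
  refine (hS.L_pos_apply H hcLI h0 hp a p).trans ?_
  rw [Int.cast_natCast, sub_self, zero_smul]

theorem W22.isSingularVector_of_Psi {cL cW cLI h hW hI : ℂ} {hcW : cW = -24 * cLI ^ 2}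
    {hhW : hW = hI * (hI - 2 * cLI)} (hinj : Function.Injective (Psi (cL := cL) (h := h) hcW hhW))
    {u : Verma cL cW h hW} (hu : u ≠ 0) {p : ℕ}
    (hv : IsHighestWeightVector (HVir.opL cL 0 cLI h hI) (HVir.opI cL 0 cLI h hI) (h + p) hI
      (Psi hcW hhW u)) : IsSingularVector u p where
  ne_zero := hu
  L_pos n hn := hinj (by rw [Psi_smul, w22Action_L, map_zero, hv.L_pos n hn])
  W_pos n hn := hinj (by
    rw [Psi_smul, w22Action_W, map_zero]
    exact (HVir.isLevelZeroRep cL cLI h hI).wMode_eq_zero_of_pos hv.mem_vacua hn)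
  L_zero := hinj (by rw [Psi_smul, w22Action_L, map_smul, hv.L_zero])
  W_zero := ⟨hI * (hI - 2 * cLI), hinj (by
    rw [Psi_smul, w22Action_W, map_smul]
    exact (HVir.isLevelZeroRep cL cLI h hI).wMode_zero_eq_smul hv.mem_vacua)⟩

theorem mainTheorem6 (p : ℕ) (hp : 0 < p) (cL cW cLI h hW hI : ℂ) (hcLI : cLI ≠ 0)
    (hratio : hW / cW = (1 - (p : ℂ) ^ 2) / 24)
    (hcW : cW = -24 * cLI ^ 2) (hhW : hW = hI * (hI - 2 * cLI))
    (hhI : hI / cLI - 1 = p) :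
    ∃ u : W22.Verma cL cW h hW,
      Psi hcW hhW ⁻¹' {schurVector cL 0 cLI h hI p} = {u} ∧ W22.IsSingularVector u p := by
  have hI_eq : hI = (p + 1) * cLI := (div_eq_iff hcLI).1 (sub_eq_iff_eq_add.1 hhI)
  have hI_ne_cLI : hI ≠ cLI := fun h => hp.ne' (by
    rw [h, div_self hcLI, sub_self] at hhI
    exact_mod_cast hhI.symm)
  have hI_ne (m : ℕ) : hI + cLI * m ≠ 0 := by
    rw [hI_eq, show (p + 1) * cLI + cLI * m = cLI * ((p + m : ℕ) + 1) by push_cast; ring]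
    exact mul_ne_zero hcLI (Nat.cast_add_one_ne_zero _)
  have hinj := Psi_injective (cL := cL) (h := h) hcW hhW hcLI hI_ne_cLI hI_ne
  obtain ⟨u, hu⟩ := schurVector_mem_range_Psi (cL := cL) (h := h) hcW hhW hcLI hI_ne p
  refine ⟨u, ?_, W22.isSingularVector_of_Psi hinj ?_ ?_⟩
  · rw [← hu, ← Set.image_singleton, Set.preimage_image_eq _ hinj]
  · rintro rfl
    exact HVir.schurVector_ne_zero hcLI hI_ne_cLI p (by rw [← hu, map_zero])
  · rw [hu]
    exact HVir.isHighestWeightVector_schurVector hcLI hI_eq
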